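/- Algorithms are real-RAM programs: memory cells hold natural or real numbers, and each addition or truncated subtraction of natural numbers, field operation on reals, conversion of a natural number to a real, comparison, indexed read or indexed write costs one step. There are a single such program and universal constants $C,c$ such that the following holds for all integers $d\ge k\ge 1$ and every $k$-dimensional linear subspace $\mathbf U\subseteq\mathbb R^d$. Given as input $d$, $k$ and the $d\times k$ matrix whose columns are any basis of $\mathbf U$, the program halts after at most $C\,dk^2\,(1+\log(dk^2))^{c}$ steps (that is, in time $\tilde O(dk^2)$) and outputs the following. 1. A list of $n\le 4k\log\log k+16$ coordinates $i_1,\dots,i_n\in\{1,\dots,d\}$ (with natural logarithms; for $k=1$ the bound is read as $n\le 16$) such that for all $u,\bar u\in\mathbf U$, $$\|u-\bar u\|_\infty\le\sqrt{2k}\,\max_{1\le j\le n}|u(i_j)-\bar u(i_j)|.$$ 2. A matrix $L\in\mathbb R^{d\times n}$, representing a linear map $\mathbb R^n\to\mathbf U$ (that is, $Lw\in\mathbf U$ for every $w\in\mathbb R^n$), such that $L\,[\bar u(i_1),\dots,\bar u(i_n)]^{\top}=\bar u$ for every $\bar u\in\mathbf U$. -/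

import Mathlib

/-!
A real RAM, presented as structured programs with a step count.  The memory holds natural-number
and real variables, one-dimensional arrays of natural numbers and two-dimensional arrays of real
numbers.  Variables and arrays are named by the constants of the program; only array *indices* are
computed.  Every primitive operation costs one step.  The only operations are addition and
(truncated) subtraction of natural numbers, the four field operations on real numbers, the inclusion
of the natural numbers in the real numbers, reads, writes and comparisons.  In particular there are
no real constants other than natural numbers, no rounding from reals to integers and no
multiplication of integers, so that unit cost is an honest measure.
-/

namespace RealRAM

/-- Memory contents. -/
@[ext] structure State where
  /-- natural-number variables -/
  natVar : ℕ → ℕ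
  /-- real variables -/
  realVar : ℕ → ℝ
  /-- arrays of natural numbers: name, index -/
  natArr : ℕ → ℕ → ℕ
  /-- two-dimensional arrays of real numbers: name, row, column -/
  realArr : ℕ → ℕ → ℕ → ℝ

/-- Natural-number expressions. -/
inductive NatExpr where
  | const (n : ℕ)
  | var (x : ℕ)
  | get (a : ℕ) (i : NatExpr)
  | add (e f : NatExpr)
  | sub (e f : NatExpr)

/-- Real expressions. -/
inductive RealExpr where
  | ofNat (e : NatExpr)
  | var (x : ℕ)
  | get (a : ℕ) (i j : NatExpr)
  | add (e f : RealExpr)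
  | sub (e f : RealExpr)
  | mul (e f : RealExpr)
  | div (e f : RealExpr)

/-- Tests. -/
inductive Test where
  | natEq (e f : NatExpr)
  | natLt (e f : NatExpr)
  | realEq (e f : RealExpr)
  | realLt (e f : RealExpr)
  | not (b : Test)
  | and (b c : Test)

/-- Programs. -/
inductive Program where
  | skip
  | setNat (x : ℕ) (e : NatExpr)
  | setReal (x : ℕ) (e : RealExpr)
  | putNat (a : ℕ) (i e : NatExpr)
  | putReal (a : ℕ) (i j : NatExpr) (e : RealExpr)
  | seq (p q : Program)
  | cond (b : Test) (p q : Program)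
  | loop (b : Test) (p : Program)

def NatExpr.eval (s : State) : NatExpr → ℕ
  | .const n => n
  | .var x => s.natVar x
  | .get a i => s.natArr a (i.eval s)
  | .add e f => e.eval s + f.eval s
  | .sub e f => e.eval s - f.eval s

/-- Division by zero returns zero, as in Mathlib. -/
noncomputable def RealExpr.eval (s : State) : RealExpr → ℝ
  | .ofNat e => (e.eval s : ℝ)
  | .var x => s.realVar x
  | .get a i j => s.realArr a (i.eval s) (j.eval s)
  | .add e f => e.eval s + f.eval s
  | .sub e f => e.eval s - f.eval s
  | .mul e f => e.eval s * f.eval s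
  | .div e f => e.eval s / f.eval s

def Test.Holds (s : State) : Test → Prop
  | .natEq e f => e.eval s = f.eval s
  | .natLt e f => e.eval s < f.eval s
  | .realEq e f => e.eval s = f.eval s
  | .realLt e f => e.eval s < f.eval s
  | .not b => ¬ b.Holds s
  | .and b c => b.Holds s ∧ c.Holds s

/-- The number of primitive operations in an expression. -/
def NatExpr.cost : NatExpr → ℕ
  | .const _ => 1
  | .var _ => 1
  | .get _ i => i.cost + 1
  | .add e f => e.cost + f.cost + 1
  | .sub e f => e.cost + f.cost + 1

def RealExpr.cost : RealExpr → ℕ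
  | .ofNat e => e.cost + 1
  | .var _ => 1
  | .get _ i j => i.cost + j.cost + 1
  | .add e f => e.cost + f.cost + 1
  | .sub e f => e.cost + f.cost + 1
  | .mul e f => e.cost + f.cost + 1
  | .div e f => e.cost + f.cost + 1

def Test.cost : Test → ℕ
  | .natEq e f => e.cost + f.cost + 1
  | .natLt e f => e.cost + f.cost + 1
  | .realEq e f => e.cost + f.cost + 1
  | .realLt e f => e.cost + f.cost + 1
  | .not b => b.cost + 1
  | .and b c => b.cost + c.cost + 1

def State.setNat (s : State) (x v : ℕ) : State :=
  { s with natVar := fun y => if y = x then v else s.natVar y }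

def State.setReal (s : State) (x : ℕ) (v : ℝ) : State :=
  { s with realVar := fun y => if y = x then v else s.realVar y }

def State.putNat (s : State) (a i v : ℕ) : State :=
  { s with natArr := fun a' i' => if a' = a ∧ i' = i then v else s.natArr a' i' }

def State.putReal (s : State) (a i j : ℕ) (v : ℝ) : State :=
  { s with realArr := fun a' i' j' =>
      if a' = a ∧ i' = i ∧ j' = j then v else s.realArr a' i' j' }

/-- `Runs p s s' t`: started in the memory `s`, the program `p` halts after exactly `t` steps with
memory `s'`. -/
inductive Runs : Program → State → State → ℕ → Prop
  | skip (s : State) : Runs .skip s s 1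
  | setNat (s : State) (x : ℕ) (e : NatExpr) :
      Runs (.setNat x e) s (s.setNat x (e.eval s)) (e.cost + 1)
  | setReal (s : State) (x : ℕ) (e : RealExpr) :
      Runs (.setReal x e) s (s.setReal x (e.eval s)) (e.cost + 1)
  | putNat (s : State) (a : ℕ) (i e : NatExpr) :
      Runs (.putNat a i e) s (s.putNat a (i.eval s) (e.eval s)) (i.cost + e.cost + 1)
  | putReal (s : State) (a : ℕ) (i j : NatExpr) (e : RealExpr) :
      Runs (.putReal a i j e) s (s.putReal a (i.eval s) (j.eval s) (e.eval s))
        (i.cost + j.cost + e.cost + 1)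
  | seq {p q : Program} {s s' s'' : State} {t t' : ℕ} :
      Runs p s s' t → Runs q s' s'' t' → Runs (.seq p q) s s'' (t + t')
  | condTrue {b : Test} {p q : Program} {s s' : State} {t : ℕ} :
      b.Holds s → Runs p s s' t → Runs (.cond b p q) s s' (b.cost + 1 + t)
  | condFalse {b : Test} {p q : Program} {s s' : State} {t : ℕ} :
      ¬ b.Holds s → Runs q s s' t → Runs (.cond b p q) s s' (b.cost + 1 + t)
  | loopStop {b : Test} {p : Program} {s : State} :
      ¬ b.Holds s → Runs (.loop b p) s s (b.cost + 1)
  | loopStep {b : Test} {p : Program} {s s' s'' : State} {t t' : ℕ} :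
      b.Holds s → Runs p s s' t → Runs (.loop b p) s' s'' t' →
        Runs (.loop b p) s s'' (b.cost + 1 + t + t')

/-- The initial memory on input a `d × k` matrix `A`: natural-number variables `0` and `1` hold `d`
and `k`, real array `0` holds `A`, and everything else is zero. -/
noncomputable def inputState {d k : ℕ} (A : Matrix (Fin d) (Fin k) ℝ) : State where
  natVar x := if x = 0 then d else if x = 1 then k else 0
  realVar _ := 0
  natArr _ _ := 0
  realArr a i j := if h : a = 0 ∧ i < d ∧ j < k then A ⟨i, h.2.1⟩ ⟨j, h.2.2⟩ else 0

/-- The memory `s` displays as its output the number `n` (in natural-number variable `2`), the list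
of coordinates `i₁, …, iₙ` (in natural-number array `0`) and the `d × n` matrix `L` (in real
array `1`). Coordinates, rows and columns are numbered from zero. -/
def State.Outputs (s : State) {d n : ℕ} (core : Fin n → Fin d) (L : Matrix (Fin d) (Fin n) ℝ) :
    Prop :=
  s.natVar 2 = n ∧ (∀ j : Fin n, s.natArr 0 j = (core j : ℕ)) ∧
    ∀ (i : Fin d) (j : Fin n), s.realArr 1 i j = L i j

end RealRAM

/-- The `d × k` matrix whose columns are the vectors of a basis of a subspace of `ℝ^d`. -/
noncomputable def basisMatrix {d k : ℕ} {U : Submodule ℝ (Fin d → ℝ)} (b : Module.Basis (Fin k) ℝ U) :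
    Matrix (Fin d) (Fin k) ℝ :=
  Matrix.of fun i j => (b j : Fin d → ℝ) i

/-! Write U as the set of vectors (m_i · z)_i, where m_i are the rows of a d × k matrix M. For a
list of rows, repetitions allowed, let V be the sum of m mᵀ over the list, and call m_iᵀ V⁻¹ m_i the
leverage of row i. By Cauchy–Schwarz, (m_i · z)² is at most the leverage of i times the sum of (m ·
z)² over the list (`sq_dotProduct_le_of_vecMul_momentMatrix`). If the list has 4k entries and all d
leverages are at most 1/2, the factor is 4k / 2 = 2k, which is the claimed norm bound.
Reconstruction is least squares: L has entries m_iᵀ V⁻¹ m over the listed m.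

Such a list is reached by exchanges that increase det V. Appending a row of leverage above 1/2
multiplies the determinant by more than 3/2 (`IsDualArray.insert`). The leverages of listed rows
always sum to tr(V⁻¹ V) = k, so among 4k + 1 of them one is at most 1/4, and removing it costs a
factor of at least 3/4 (`IsDualArray.remove`). Each exchange therefore gains a factor 9/8.

The number of exchanges is O(k log(4k)) because the basis is chosen well. Elimination that pivots on
the largest entry of each column gives M = B R with entries of B in [-1, 1] and det R = 1, so det V
≤ k! (4k)^k for every list of length 4k (`Eliminated.det_momentMatrix_le`). Four copies of each
pivot row give V = 4I, a start with determinant at least 1.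

The array Y = M V⁻¹ is kept throughout and updated by the Sherman–Morrison formula, so an exchange,
including the search for it, takes O(dk) steps. Elimination and output take O(dk²). The remaining
analytic fact is 4k ≤ 4k log log k + 16. -/

namespace RealRAM

/-! ### Frame conditions -/

/-- Whether the program assigns to the natural-number variable `x`. -/
def Program.writesNat (x : ℕ) : Program → Bool
  | .setNat y _ => x == y
  | .seq p q => p.writesNat x || q.writesNat x
  | .cond _ p q => p.writesNat x || q.writesNat x
  | .loop _ p => p.writesNat x
  | _ => false

/-- Whether the program assigns to the real variable `x`. -/
def Program.writesReal (x : ℕ) : Program → Bool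
  | .setReal y _ => x == y
  | .seq p q => p.writesReal x || q.writesReal x
  | .cond _ p q => p.writesReal x || q.writesReal x
  | .loop _ p => p.writesReal x
  | _ => false

/-- Whether the program writes to the array `a` of natural numbers. -/
def Program.writesNatArr (a : ℕ) : Program → Bool
  | .putNat a' _ _ => a == a'
  | .seq p q => p.writesNatArr a || q.writesNatArr a
  | .cond _ p q => p.writesNatArr a || q.writesNatArr a
  | .loop _ p => p.writesNatArr a
  | _ => false

/-- Whether the program writes to the array `a` of real numbers. -/
def Program.writesRealArr (a : ℕ) : Program → Bool
  | .putReal a' _ _ _ => a == a'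
  | .seq p q => p.writesRealArr a || q.writesRealArr a
  | .cond _ p q => p.writesRealArr a || q.writesRealArr a
  | .loop _ p => p.writesRealArr a
  | _ => false

/-- The memories `s` and `s'` agree on everything that `P` does not write to. -/
structure Program.Frame (P : Program) (s s' : State) : Prop where
  natVar : ∀ x, P.writesNat x = false → s'.natVar x = s.natVar x
  realVar : ∀ x, P.writesReal x = false → s'.realVar x = s.realVar x
  natArr : ∀ a, P.writesNatArr a = false → s'.natArr a = s.natArr a
  realArr : ∀ a, P.writesRealArr a = false → s'.realArr a = s.realArr a

theorem Program.Frame.refl (P : Program) (s : State) : P.Frame s s :=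
  ⟨fun _ _ => rfl, fun _ _ => rfl, fun _ _ => rfl, fun _ _ => rfl⟩

theorem Program.Frame.trans {P : Program} {s s' s'' : State} (h : P.Frame s s')
    (h' : P.Frame s' s'') : P.Frame s s'' where
  natVar x hx := (h'.natVar x hx).trans (h.natVar x hx)
  realVar x hx := (h'.realVar x hx).trans (h.realVar x hx)
  natArr x hx := (h'.natArr x hx).trans (h.natArr x hx)
  realArr x hx := (h'.realArr x hx).trans (h.realArr x hx)

theorem Program.Frame.weaken {P Q : Program} {s s' : State} (h : P.Frame s s')
    (h₁ : ∀ x, Q.writesNat x = false → P.writesNat x = false)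
    (h₂ : ∀ x, Q.writesReal x = false → P.writesReal x = false)
    (h₃ : ∀ x, Q.writesNatArr x = false → P.writesNatArr x = false)
    (h₄ : ∀ x, Q.writesRealArr x = false → P.writesRealArr x = false) : Q.Frame s s' where
  natVar x hx := h.natVar x (h₁ x hx)
  realVar x hx := h.realVar x (h₂ x hx)
  natArr x hx := h.natArr x (h₃ x hx)
  realArr x hx := h.realArr x (h₄ x hx)

theorem Program.Frame.seq_left {p q : Program} {s s' : State} (h : p.Frame s s') :
    (p.seq q).Frame s s' := by
  apply h.weaken <;>
    simp +contextual [Program.writesNat, Program.writesReal, Program.writesNatArr,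
      Program.writesRealArr]

theorem Program.Frame.seq_right {p q : Program} {s s' : State} (h : q.Frame s s') :
    (p.seq q).Frame s s' := by
  apply h.weaken <;>
    simp +contextual [Program.writesNat, Program.writesReal, Program.writesNatArr,
      Program.writesRealArr]

theorem Program.Frame.cond_left {b : Test} {p q : Program} {s s' : State} (h : p.Frame s s') :
    (Program.cond b p q).Frame s s' := by
  apply h.weaken <;>
    simp +contextual [Program.writesNat, Program.writesReal, Program.writesNatArr,
      Program.writesRealArr]

theorem Program.Frame.cond_right {b : Test} {p q : Program} {s s' : State} (h : q.Frame s s') :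
    (Program.cond b p q).Frame s s' := by
  apply h.weaken <;>
    simp +contextual [Program.writesNat, Program.writesReal, Program.writesNatArr,
      Program.writesRealArr]

theorem Program.Frame.loop {b : Test} {p : Program} {s s' : State} (h : p.Frame s s') :
    (Program.loop b p).Frame s s' := by
  apply h.weaken <;>
    simp +contextual [Program.writesNat, Program.writesReal, Program.writesNatArr,
      Program.writesRealArr]

/-- Which variables and arrays are assigned is read off the program text, so for concrete programs
the hypothesis of each frame fact is closed by `rfl`. -/
theorem Runs.frame {P : Program} {s s' : State} {t : ℕ} (h : Runs P s s' t) : P.Frame s s' := by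
  induction h with
  | skip s => exact .refl _ s
  | setNat s x e =>
    exact ⟨fun y hy => by simp_all [Program.writesNat, State.setNat], fun _ _ => rfl,
      fun _ _ => rfl, fun _ _ => rfl⟩
  | setReal s x e =>
    exact ⟨fun _ _ => rfl, fun y hy => by simp_all [Program.writesReal, State.setReal],
      fun _ _ => rfl, fun _ _ => rfl⟩
  | putNat s a i e =>
    exact ⟨fun _ _ => rfl, fun _ _ => rfl,
      fun y hy => by ext; simp_all [Program.writesNatArr, State.putNat], fun _ _ => rfl⟩
  | putReal s a i j e =>
    exact ⟨fun _ _ => rfl, fun _ _ => rfl, fun _ _ => rfl,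
      fun y hy => by ext; simp_all [Program.writesRealArr, State.putReal]⟩
  | seq _ _ h₁ h₂ => exact h₁.seq_left.trans h₂.seq_right
  | condTrue _ _ h => exact h.cond_left
  | condFalse _ _ h => exact h.cond_right
  | loopStop _ => exact .refl _ _
  | loopStep _ _ _ h₁ h₂ => exact h₁.loop.trans h₂

/-! ### Total correctness with time bounds -/

/-- Started in `s`, the program `P` halts within `T` steps in a memory satisfying `Q`. -/
def Ends (P : Program) (s : State) (T : ℕ) (Q : State → Prop) : Prop :=
  ∃ s' t, Runs P s s' t ∧ t ≤ T ∧ Q s'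

theorem Ends.le {P : Program} {s : State} {T T' : ℕ} {Q : State → Prop} (h : Ends P s T Q)
    (hT : T ≤ T') : Ends P s T' Q :=
  let ⟨s', t, hr, ht, hq⟩ := h
  ⟨s', t, hr, ht.trans hT, hq⟩

theorem Ends.mono {P : Program} {s : State} {T : ℕ} {Q Q' : State → Prop} (h : Ends P s T Q)
    (hQ : ∀ s', P.Frame s s' → Q s' → Q' s') : Ends P s T Q' :=
  let ⟨s', t, hr, ht, hq⟩ := h
  ⟨s', t, hr, ht, hQ s' hr.frame hq⟩

theorem Ends.bind {p q : Program} {s : State} {T T' : ℕ} {Q Q' : State → Prop}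
    (h : Ends p s T Q) (h' : ∀ s', p.Frame s s' → Q s' → Ends q s' T' Q') :
    Ends (p.seq q) s (T + T') Q' :=
  let ⟨s', _, hr, ht, hq⟩ := h
  let ⟨s'', _, hr', ht', hq'⟩ := h' s' hr.frame hq
  ⟨s'', _, hr.seq hr', add_le_add ht ht', hq'⟩

theorem Ends.skip {s : State} {Q : State → Prop} (h : Q s) : Ends .skip s 1 Q :=
  ⟨_, _, .skip s, le_rfl, h⟩

theorem Ends.setNat {s : State} {x : ℕ} {e : NatExpr} {Q : State → Prop}
    (h : Q (s.setNat x (e.eval s))) : Ends (.setNat x e) s (e.cost + 1) Q :=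
  ⟨_, _, .setNat s x e, le_rfl, h⟩

theorem Ends.setReal {s : State} {x : ℕ} {e : RealExpr} {Q : State → Prop}
    (h : Q (s.setReal x (e.eval s))) : Ends (.setReal x e) s (e.cost + 1) Q :=
  ⟨_, _, .setReal s x e, le_rfl, h⟩

theorem Ends.putNat {s : State} {a : ℕ} {i e : NatExpr} {Q : State → Prop}
    (h : Q (s.putNat a (i.eval s) (e.eval s))) :
    Ends (.putNat a i e) s (i.cost + e.cost + 1) Q :=
  ⟨_, _, .putNat s a i e, le_rfl, h⟩

theorem Ends.putReal {s : State} {a : ℕ} {i j : NatExpr} {e : RealExpr} {Q : State → Prop}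
    (h : Q (s.putReal a (i.eval s) (j.eval s) (e.eval s))) :
    Ends (.putReal a i j e) s (i.cost + j.cost + e.cost + 1) Q :=
  ⟨_, _, .putReal s a i j e, le_rfl, h⟩

theorem Ends.seq {p q : Program} {s : State} {T T' : ℕ} {Q : State → Prop}
    (h : Ends p s T fun s' => Ends q s' T' Q) : Ends (p.seq q) s (T + T') Q :=
  h.bind fun _ _ h => h

/-- Adding the two bounds instead of taking their maximum only affects constants and keeps the
arithmetic linear. -/
theorem Ends.cond {b : Test} {p q : Program} {s : State} {T T' : ℕ} {Q : State → Prop}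
    (h : b.Holds s → Ends p s T Q) (h' : ¬ b.Holds s → Ends q s T' Q) :
    Ends (.cond b p q) s (b.cost + 1 + (T + T')) Q := by
  by_cases hb : b.Holds s
  · obtain ⟨s', t, hr, ht, hq⟩ := h hb
    exact ⟨s', _, .condTrue hb hr, by omega, hq⟩
  · obtain ⟨s', t, hr, ht, hq⟩ := h' hb
    exact ⟨s', _, .condFalse hb hr, by omega, hq⟩

/-- A loop whose `m`-th pass is made only if `m ≤ N`. -/
theorem Ends.loop {b : Test} {p : Program} {s : State} {T N : ℕ} (Inv : ℕ → State → Prop)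
    (h₀ : Inv 0 s) (hN : ∀ m s', Inv m s' → b.Holds s' → m ≤ N)
    (hstep : ∀ m s', (Program.loop b p).Frame s s' → Inv m s' → b.Holds s' →
      Ends p s' T (Inv (m + 1))) :
    Ends (.loop b p) s ((N + 1) * (T + b.cost + 1) + b.cost + 1)
      fun s' => ¬ b.Holds s' ∧ ∃ m, Inv m s' := by
  -- Induction on the number r of passes still allowed; passes are counted from 0, so N + 1 are
  -- allowed in all.
  have key : ∀ r m s', m + r = N + 1 → (Program.loop b p).Frame s s' → Inv m s' →
      Ends (.loop b p) s' (r * (T + b.cost + 1) + b.cost + 1)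
        fun s' => ¬ b.Holds s' ∧ ∃ m, Inv m s' := by
    intro r
    induction r with
    | zero =>
      intro m s' hm hF hI
      by_cases hb : b.Holds s'
      · have := hN m s' hI hb
        omega
      · exact ⟨s', _, .loopStop hb, by omega, hb, m, hI⟩
    | succ r ih =>
      intro m s' hm hF hI
      by_cases hb : b.Holds s'
      · obtain ⟨s₁, t₁, hr₁, ht₁, hq₁⟩ := hstep m s' hF hI hb
        obtain ⟨s₂, t₂, hr₂, ht₂, hq₂⟩ :=
          ih (m + 1) s₁ (by omega) (hF.trans hr₁.frame.loop) hq₁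
        refine ⟨s₂, _, .loopStep hb hr₁ hr₂, ?_, hq₂⟩
        rw [Nat.succ_mul]
        omega
      · exact ⟨s', _, .loopStop hb, by omega, hb, m, hI⟩
  exact key (N + 1) 0 s (by omega) (.refl _ s) h₀

/-- `for x < y do body` -/
def Program.forLt (x y : ℕ) (body : Program) : Program :=
  .seq (.setNat x (.const 0)) (.loop (.natLt (.var x) (.var y))
    (.seq body (.setNat x (.add (.var x) (.const 1)))))

/-- A pass pays 4 for the test and 4 for the increment; the 6 is the initial assignment and the
final failing test. The invariant is required after the counter has been advanced, so it may also
speak of the counter. -/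
theorem Ends.forLt {x y : ℕ} {body : Program} {s : State} {n T : ℕ} (Inv : ℕ → State → Prop)
    (hn : s.natVar y = n) (hxy : y ≠ x) (hx : body.writesNat x = false)
    (hy : body.writesNat y = false) (h₀ : Inv 0 (s.setNat x 0))
    (hstep : ∀ i s', i < n → (Program.forLt x y body).Frame s s' → s'.natVar x = i → Inv i s' →
      Ends body s' T fun s'' => Inv (i + 1) (s''.setNat x (i + 1))) :
    Ends (.forLt x y body) s (n * (T + 8) + 6) (Inv n) := by
  have hF₀ : (Program.forLt x y body).Frame s (s.setNat x 0) :=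
    (Runs.setNat s x (.const 0)).frame.seq_left
  refine (Ends.seq (T := 2) (T' := n * (T + 8) + 4) (Ends.setNat ?_)).le (by omega)
  have key : ∀ r i s', i + r = n → (Program.forLt x y body).Frame s s' → s'.natVar x = i →
      Inv i s' → Ends (.loop (.natLt (.var x) (.var y))
        (.seq body (.setNat x (.add (.var x) (.const 1))))) s' (r * (T + 8) + 4) (Inv n) := by
    intro r
    induction r with
    | zero =>
      intro i s' hi hF hxi hI
      have hyn : s'.natVar y = n := by
        rw [hF.natVar y (by simp [Program.forLt, Program.writesNat, hxy, hy]), hn]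
      obtain rfl : i = n := by omega
      exact ⟨s', _, .loopStop (by simp [Test.Holds, NatExpr.eval, hxi, hyn]),
        by simp [Test.cost, NatExpr.cost], hI⟩
    | succ r ih =>
      intro i s' hi hF hxi hI
      have hyn : s'.natVar y = n := by
        rw [hF.natVar y (by simp [Program.forLt, Program.writesNat, hxy, hy]), hn]
      obtain ⟨s₁, t₁, hr₁, ht₁, hq₁⟩ := hstep i s' (by omega) hF hxi hI
      have hx₁ : s₁.natVar x = i := by rw [hr₁.frame.natVar x hx, hxi]
      have hr₂ := hr₁.seq (.setNat s₁ x (.add (.var x) (.const 1)))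
      have hv : (NatExpr.add (.var x) (.const 1)).eval s₁ = i + 1 := by simp [NatExpr.eval, hx₁]
      rw [hv] at hr₂
      obtain ⟨s₃, t₃, hr₃, ht₃, hq₃⟩ := ih (i + 1) (s₁.setNat x (i + 1)) (by omega)
        (hF.trans (hr₂.frame.loop.seq_right)) (by simp [State.setNat]) hq₁
      refine ⟨s₃, _, .loopStep (by simp [Test.Holds, NatExpr.eval, hxi, hyn]; omega) hr₂ hr₃, ?_,
        hq₃⟩
      simp only [Test.cost, NatExpr.cost, Nat.succ_mul]
      omega
  exact key n 0 _ (by omega) hF₀ (by simp [State.setNat, NatExpr.eval]) h₀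

end RealRAM

open Matrix

/-! ### Moment matrices: rank-one updates, leverages, determinants -/

section LinearAlgebra

variable {k : ℕ}

/-- The sum of the rank-one matrices `v vᵀ` over the vectors `v = m (S x)`, `x < n`. -/
def momentMatrix (m : ℕ → Fin k → ℝ) (S : ℕ → ℕ) (n : ℕ) : Matrix (Fin k) (Fin k) ℝ :=
  ∑ x ∈ Finset.range n, vecMulVec (m (S x)) (m (S x))

theorem momentMatrix_transpose (m : ℕ → Fin k → ℝ) (S : ℕ → ℕ) (n : ℕ) :
    (momentMatrix m S n)ᵀ = momentMatrix m S n := by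
  simp [momentMatrix, transpose_sum, transpose_vecMulVec]

theorem momentMatrix_succ (m : ℕ → Fin k → ℝ) (S : ℕ → ℕ) (n : ℕ) :
    momentMatrix m S (n + 1) = momentMatrix m S n + vecMulVec (m (S n)) (m (S n)) :=
  Finset.sum_range_succ _ _

theorem momentMatrix_congr {m : ℕ → Fin k → ℝ} {S S' : ℕ → ℕ} {n : ℕ}
    (h : ∀ x < n, S x = S' x) : momentMatrix m S n = momentMatrix m S' n :=
  Finset.sum_congr rfl fun x hx => by rw [h x (Finset.mem_range.mp hx)]

/-- Removal from an unordered list in constant time: the last entry is moved into position q. The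
case q = n, where the last entry itself is removed, is included. -/
theorem momentMatrix_swap {m : ℕ → Fin k → ℝ} {S S' : ℕ → ℕ} {n q : ℕ} (hq : q ≤ n)
    (h : ∀ x < n, S' x = if x = q then S n else S x) :
    momentMatrix m S' n = momentMatrix m S (n + 1) - vecMulVec (m (S q)) (m (S q)) := by
  rw [momentMatrix_succ]
  rcases hq.eq_or_lt with rfl | hq
  · rw [add_sub_cancel_right]
    exact momentMatrix_congr fun x hx => by rw [h x hx, if_neg hx.ne]
  · have h₁ : momentMatrix m S' n = vecMulVec (m (S n)) (m (S n)) +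
        ∑ x ∈ (Finset.range n).erase q, vecMulVec (m (S x)) (m (S x)) := by
      rw [momentMatrix, ← Finset.add_sum_erase _ _ (Finset.mem_range.mpr hq), h q hq, if_pos rfl]
      congr 1
      refine Finset.sum_congr rfl fun x hx => ?_
      rw [Finset.mem_erase, Finset.mem_range] at hx
      rw [h x hx.2, if_neg hx.1]
    have h₂ : momentMatrix m S n = vecMulVec (m (S q)) (m (S q)) +
        ∑ x ∈ (Finset.range n).erase q, vecMulVec (m (S x)) (m (S x)) := by
      rw [momentMatrix, ← Finset.add_sum_erase _ _ (Finset.mem_range.mpr hq)]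
    rw [h₁, h₂]
    abel

theorem vecMul_momentMatrix_dotProduct (m : ℕ → Fin k → ℝ) (S : ℕ → ℕ) (n : ℕ)
    (u z : Fin k → ℝ) : (u ᵥ* momentMatrix m S n) ⬝ᵥ z =
      ∑ x ∈ Finset.range n, (u ⬝ᵥ m (S x)) * (m (S x) ⬝ᵥ z) := by
  rw [momentMatrix, vecMul_sum, sum_dotProduct]
  refine Finset.sum_congr rfl fun x _ => ?_
  rw [vecMul_vecMulVec, smul_dotProduct, smul_eq_mul]

/-- For invertible V both sides are w V⁻¹ w'. Phrasing V⁻¹ through solutions of u V = w avoids any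
invertibility hypothesis. -/
theorem dotProduct_comm_of_vecMul {V : Matrix (Fin k) (Fin k) ℝ} (hV : Vᵀ = V)
    {u u' w w' : Fin k → ℝ} (h : u ᵥ* V = w) (h' : u' ᵥ* V = w') : w ⬝ᵥ u' = w' ⬝ᵥ u := by
  have : V *ᵥ u' = w' := by rw [← h', ← vecMul_transpose, hV]
  rw [← h, ← dotProduct_mulVec, this, dotProduct_comm]

theorem dotProduct_nonneg_of_vecMul_momentMatrix {m : ℕ → Fin k → ℝ} {S : ℕ → ℕ} {n : ℕ}
    {u w : Fin k → ℝ} (h : u ᵥ* momentMatrix m S n = w) : 0 ≤ w ⬝ᵥ u := by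
  rw [← h, vecMul_momentMatrix_dotProduct]
  refine Finset.sum_nonneg fun x _ => ?_
  rw [dotProduct_comm]
  exact mul_self_nonneg _

/-- The Sherman–Morrison formula. -/
theorem vecMul_rankOne_update {V : Matrix (Fin k) (Fin k) ℝ} (hV : Vᵀ = V)
    {u w v y : Fin k → ℝ} (hu : u ᵥ* V = w) (hy : y ᵥ* V = v) {c σ : ℝ}
    (hc : c * (1 + σ * (v ⬝ᵥ y)) = σ) :
    (u - (c * (w ⬝ᵥ y)) • y) ᵥ* (V + σ • vecMulVec v v) = w := by
  have huv : u ⬝ᵥ v = w ⬝ᵥ y := by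
    rw [dotProduct_comm, dotProduct_comm_of_vecMul hV hu hy]
  have hyv : y ⬝ᵥ v = v ⬝ᵥ y := dotProduct_comm _ _
  rw [vecMul_add, sub_vecMul, smul_vecMul, hu, hy, vecMul_smul, vecMul_vecMulVec, sub_dotProduct,
    smul_dotProduct, huv, hyv]
  ext i
  simp only [Pi.add_apply, Pi.sub_apply, Pi.smul_apply, smul_eq_mul]
  -- The relation `hc` is free of division, so it serves insertion (σ = 1, c = 1 / (1 + g)) and
  -- removal (σ = -1, c = 1 / (g - 1)) alike, with g = v · y.
  linear_combination (-(w ⬝ᵥ y) * v i) * hc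

/-- The matrix determinant lemma, with v V⁻¹ replaced by the solution y. -/
theorem det_rankOne_update {V : Matrix (Fin k) (Fin k) ℝ} (hdet : V.det ≠ 0) {v y : Fin k → ℝ}
    (hy : y ᵥ* V = v) (σ : ℝ) :
    (V + σ • vecMulVec v v).det = V.det * (1 + σ * (v ⬝ᵥ y)) := by
  have hy' : y = v ᵥ* V⁻¹ := by
    rw [← hy, vecMul_vecMul, mul_nonsing_inv _ (isUnit_iff_ne_zero.mpr hdet), vecMul_one]
  have := det_add_replicateCol_mul_replicateRow (ι := Unit) (isUnit_iff_ne_zero.mpr hdet)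
    (σ • v) v
  rw [← vecMulVec_eq, smul_vecMulVec] at this
  have h' : (replicateRow Unit v * V⁻¹ * replicateCol Unit (σ • v)) () () = σ * (v ⬝ᵥ y) := by
    rw [hy', dotProduct_comm v]
    exact dotProduct_smul σ (v ᵥ* V⁻¹) v
  rw [this, det_unique (n := Unit), Matrix.add_apply, Matrix.one_apply_eq]
  exact congrArg (fun g => V.det * (1 + g)) h'

/-- Both sides are the trace of V⁻¹ V: expanding V into rank-one terms, the trace of V⁻¹ m mᵀ is the
leverage of m. -/
theorem sum_dotProduct_of_vecMul_momentMatrix {m y : ℕ → Fin k → ℝ} {S : ℕ → ℕ} {n : ℕ}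
    (hdet : (momentMatrix m S n).det ≠ 0)
    (h : ∀ x < n, y (S x) ᵥ* momentMatrix m S n = m (S x)) :
    ∑ x ∈ Finset.range n, m (S x) ⬝ᵥ y (S x) = k := by
  set V := momentMatrix m S n with hV
  have hu : IsUnit V.det := isUnit_iff_ne_zero.mpr hdet
  have h₁ : (V⁻¹ * V).trace = k := by rw [nonsing_inv_mul _ hu]; simp
  rw [← h₁]
  conv_rhs => rw [hV, momentMatrix, Matrix.mul_sum, trace_sum, ← momentMatrix, ← hV]
  refine Finset.sum_congr rfl fun x hx => ?_
  have hy : y (S x) = m (S x) ᵥ* V⁻¹ := by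
    rw [← h x (Finset.mem_range.mp hx), vecMul_vecMul, mul_nonsing_inv _ hu, vecMul_one]
  rw [mul_vecMulVec, trace_vecMulVec, hy, dotProduct_comm, ← dotProduct_mulVec, dotProduct_comm]

/-- If the vectors `m i` are, up to a unimodular change of coordinates, vectors with entries in
`[-1, 1]`, then their moment matrices have bounded determinant. -/
theorem det_momentMatrix_le {d : ℕ} {m B : ℕ → Fin k → ℝ} {R : Matrix (Fin k) (Fin k) ℝ}
    (hB : ∀ i < d, ∀ c, |B i c| ≤ 1) (hR : R.det = 1) (hm : ∀ i < d, m i = B i ᵥ* R)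
    (S : ℕ → ℕ) (n : ℕ) (hS : ∀ x < n, S x < d) :
    (momentMatrix m S n).det ≤ k.factorial * (n : ℝ) ^ k := by
  have h₁ : momentMatrix m S n = Rᵀ * momentMatrix B S n * R := by
    rw [momentMatrix, momentMatrix, Matrix.mul_sum, Matrix.sum_mul]
    refine Finset.sum_congr rfl fun x hx => ?_
    rw [hm _ (hS x (Finset.mem_range.mp hx)), mul_vecMulVec, vecMulVec_mul, mulVec_transpose]
  rw [h₁, det_mul, det_mul, det_transpose, hR, one_mul, mul_one]
  have h₂ : ∀ i j, IsAbsoluteValue.toAbsoluteValue (abs : ℝ → ℝ) (momentMatrix B S n i j) ≤ n := by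
    intro i j
    change |momentMatrix B S n i j| ≤ n
    rw [momentMatrix, Matrix.sum_apply]
    refine (Finset.abs_sum_le_sum_abs _ _).trans ?_
    refine (Finset.sum_le_card_nsmul _ _ 1 fun x hx => ?_).trans (by simp)
    have hx' := hS x (Finset.mem_range.mp hx)
    rw [vecMulVec_apply, abs_mul]
    exact mul_le_one₀ (hB _ hx' _) (abs_nonneg _) (hB _ hx' _)
  -- Leibniz expansion: k! products of k entries, each entry a sum of n terms of absolute value at
  -- most 1.
  have h₃ := det_le h₂
  rw [Fintype.card_fin, nsmul_eq_mul] at h₃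
  exact (le_abs_self _).trans h₃

/-- The Cauchy–Schwarz bound on a linear functional by its values on the vectors `m (S x)`. -/
theorem sq_dotProduct_le_of_vecMul_momentMatrix {m : ℕ → Fin k → ℝ} {S : ℕ → ℕ} {n : ℕ}
    {u w : Fin k → ℝ} (h : u ᵥ* momentMatrix m S n = w) (z : Fin k → ℝ) :
    (w ⬝ᵥ z) ^ 2 ≤ (w ⬝ᵥ u) * ∑ x ∈ Finset.range n, (m (S x) ⬝ᵥ z) ^ 2 := by
  have h₁ : w ⬝ᵥ u = ∑ x ∈ Finset.range n, (u ⬝ᵥ m (S x)) ^ 2 := by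
    rw [← h, vecMul_momentMatrix_dotProduct]
    exact Finset.sum_congr rfl fun x _ => by rw [dotProduct_comm (m (S x)), sq]
  rw [h₁, ← h, vecMul_momentMatrix_dotProduct]
  exact Finset.sum_mul_sq_le_sq_mul_sq _ _ _

end LinearAlgebra

/-! ### Gauss–Jordan elimination by columns -/

/-- The state of the elimination after `j` of the `k` columns of a `d × k` matrix `M` with columns
in `U`; `S` lists the pivot rows. The matrix `B` is the unit lower trapezoidal factor. -/
structure Eliminated {d : ℕ} (k : ℕ) (U : Submodule ℝ (Fin d → ℝ)) (j : ℕ) (M : ℕ → ℕ → ℝ)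
    (S : ℕ → ℕ) : Prop where
  mem : ∀ b < k, (fun i : Fin d => M i b) ∈ U
  indep : ∀ z : ℕ → ℝ, (∀ i < d, ∑ b ∈ Finset.range k, M i b * z b = 0) → ∀ b < k, z b = 0
  pivot_lt : ∀ a < j, S a < d
  pivot : ∀ a < j, ∀ b < k, M (S a) b = if b = a then 1 else 0
  factor : ∃ B : ℕ → ℕ → ℝ, (∀ i < d, ∀ c < j, |B i c| ≤ 1) ∧ (∀ c < j, B (S c) c = 1) ∧
    (∀ a c, a < c → c < j → B (S a) c = 0) ∧
    ∀ b < j, ∃ r : ℕ → ℝ, ∀ i < d, M i b = ∑ c ∈ Finset.range j, B i c * r c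

namespace Eliminated

variable {d k j : ℕ} {U : Submodule ℝ (Fin d → ℝ)} {M : ℕ → ℕ → ℝ} {S : ℕ → ℕ}

/-- If the largest entry were 0, the whole column would vanish, against linear independence of the
columns. -/
theorem pivot_ne_zero (h : Eliminated k U j M S) (hj : j < k) {p : ℕ}
    (hmax : ∀ i < d, M i j ^ 2 ≤ M p j ^ 2) : M p j ≠ 0 := by
  intro h0
  have := h.indep (fun b => if b = j then 1 else 0) (fun i hi => by
    have := hmax i hi
    rw [h0] at this
    simp [hj]
    nlinarith) j hj
  simp at this

/-- The maximum may be taken over all rows: earlier pivot rows have entry 0 in column j, while the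
pivot is nonzero. Dividing by the largest entry is what keeps the new column of the factor within
[-1, 1]. -/
theorem step (h : Eliminated k U j M S) (hj : j < k) {p : ℕ} (hp : p < d)
    (hmax : ∀ i < d, M i j ^ 2 ≤ M p j ^ 2) {M' : ℕ → ℕ → ℝ} {S' : ℕ → ℕ}
    (hM' : ∀ i < d, ∀ b < k, M' i b =
      if b = j then M i j / M p j else M i b - M p b * (M i j / M p j))
    (hS' : ∀ a < j, S' a = S a) (hSj : S' j = p) : Eliminated k U (j + 1) M' S' := by
  have hne := h.pivot_ne_zero hj hmax
  have hcol : (fun i : Fin d => M' i j) = (M p j)⁻¹ • fun i : Fin d => M i j := by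
    ext i
    rw [hM' i i.2 j hj, if_pos rfl, Pi.smul_apply, smul_eq_mul, div_eq_inv_mul]
  have hle : ∀ i < d, |M i j / M p j| ≤ 1 := fun i hi => by
    rw [abs_div, div_le_one (abs_pos.mpr hne)]
    exact sq_le_sq.mp (hmax i hi)
  constructor
  · intro b hb
    by_cases hbj : b = j
    · rw [hbj, hcol]
      exact U.smul_mem _ (h.mem j hj)
    · have : (fun i : Fin d => M' i b) =
          (fun i : Fin d => M i b) - (M p b * (M p j)⁻¹) • fun i : Fin d => M i j := by
        ext i
        rw [hM' i i.2 b hb, if_neg hbj, Pi.sub_apply, Pi.smul_apply, smul_eq_mul]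
        ring
      rw [this]
      exact U.sub_mem (h.mem b hb) (U.smul_mem _ (h.mem j hj))
  · intro z hz
    have hmem : j ∈ Finset.range k := Finset.mem_range.mpr hj
    -- A relation z among the new columns is a relation among the old ones once the coefficient of
    -- column j is adjusted as below.
    have hz' := h.indep
      (fun b => if b = j then
        (z j - ∑ c ∈ (Finset.range k).erase j, M p c * z c) / M p j else z b) (fun i hi => by
        have h₁ := hz i hi
        rw [← Finset.add_sum_erase _ _ hmem, hM' i hi j hj, if_pos rfl] at h₁
        rw [← Finset.add_sum_erase _ _ hmem, if_pos rfl, ← h₁]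
        have h₂ : ∑ b ∈ (Finset.range k).erase j, M' i b * z b =
            ∑ b ∈ (Finset.range k).erase j, M i b * z b -
              (∑ b ∈ (Finset.range k).erase j, M p b * z b) * (M i j / M p j) := by
          rw [Finset.sum_mul, ← Finset.sum_sub_distrib]
          refine Finset.sum_congr rfl fun b hb => ?_
          rw [Finset.mem_erase, Finset.mem_range] at hb
          rw [hM' i hi b hb.2, if_neg hb.1]
          ring
        have h₃ : ∀ f : ℝ, ∑ b ∈ (Finset.range k).erase j,
            M i b * (if b = j then f else z b) =
            ∑ b ∈ (Finset.range k).erase j, M i b * z b := fun f =>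
          Finset.sum_congr rfl fun b hb => by rw [if_neg (Finset.mem_erase.mp hb).1]
        rw [h₂, h₃]
        ring)
    have hz₀ : ∀ b < k, b ≠ j → z b = 0 := fun b hb hbj => by
      have := hz' b hb
      rwa [if_neg hbj] at this
    have hzj := hz' j hj
    rw [if_pos rfl, Finset.sum_eq_zero, sub_zero, div_eq_zero_iff, or_iff_left hne] at hzj
    · intro b hb
      by_cases hbj : b = j
      · rw [hbj, hzj]
      · exact hz₀ b hb hbj
    · intro b hb
      rw [Finset.mem_erase, Finset.mem_range] at hb
      rw [hz₀ b hb.2 hb.1, mul_zero]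
  · intro a ha
    rcases Nat.lt_succ_iff_lt_or_eq.mp ha with ha | rfl
    · rw [hS' a ha]
      exact h.pivot_lt a ha
    · rwa [hSj]
  · intro a ha b hb
    rcases Nat.lt_succ_iff_lt_or_eq.mp ha with ha | rfl
    · have h0 : M (S a) j = 0 := by rw [h.pivot a ha j hj, if_neg ha.ne']
      rw [hS' a ha, hM' _ (h.pivot_lt a ha) b hb, h0, zero_div, mul_zero, sub_zero]
      by_cases hbj : b = j
      · rw [if_pos hbj, hbj, if_neg ha.ne']
      · rw [if_neg hbj, h.pivot a ha b hb]
    · rw [hSj, hM' p hp b hb, div_self hne, mul_one, sub_self]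
  · obtain ⟨B, hB, hB₁, hB₀, hBM⟩ := h.factor
    -- The factor gains the normalized column j. It is 1 at the new pivot row and 0 at the earlier
    -- ones, which preserves the unit lower triangular shape on pivot rows.
    refine ⟨fun i c => if c = j then M i j / M p j else B i c, ?_, ?_, ?_, ?_⟩
    · intro i hi c hc
      by_cases hcj : c = j
      · simpa only [if_pos hcj] using hle i hi
      · simpa only [if_neg hcj] using hB i hi c (by omega)
    · intro c hc
      by_cases hcj : c = j
      · simp only [if_pos hcj]
        rw [hcj, hSj, div_self hne]
      · simp only [if_neg hcj]
        rw [hS' c (by omega), hB₁ c (by omega)]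
    · intro a c hac hc
      by_cases hcj : c = j
      · simp only [if_pos hcj]
        rw [hS' a (by omega), h.pivot a (by omega) j hj, if_neg (by omega), zero_div]
      · simp only [if_neg hcj]
        rw [hS' a (by omega), hB₀ a c hac (by omega)]
    · intro b hb
      by_cases hbj : b = j
      · refine ⟨fun c => if c = j then 1 else 0, fun i hi => ?_⟩
        rw [hbj, hM' i hi j hj, if_pos rfl]
        simp
      · obtain ⟨r, hr⟩ := hBM b (by omega)
        -- Column b changed by subtracting M p b times the new column of the factor.
        refine ⟨fun c => if c = j then - M p b else r c, fun i hi => ?_⟩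
        rw [hM' i hi b (by omega), if_neg hbj, Finset.sum_range_succ, hr i hi, sub_eq_add_neg]
        congr 1
        · refine Finset.sum_congr rfl fun c hc => ?_
          simp only [if_neg (Finset.mem_range.mp hc).ne]
        · simp only [if_pos]
          ring

end Eliminated

/-- The first `k` entries of row `i` of an array. -/
def arrayRow (k : ℕ) (A : ℕ → ℕ → ℝ) (i : ℕ) : Fin k → ℝ := fun b => A i b

namespace Eliminated

variable {d k : ℕ} {U : Submodule ℝ (Fin d → ℝ)} {M : ℕ → ℕ → ℝ} {S : ℕ → ℕ}

theorem arrayRow_pivot (h : Eliminated k U k M S) {a : ℕ} (ha : a < k) :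
    arrayRow k M (S a) = Pi.single ⟨a, ha⟩ 1 := by
  ext b
  rw [arrayRow, h.pivot a ha b b.2, Pi.single_apply]
  simp [Fin.ext_iff]

/-- In M = B R the pivot rows of M form the identity and those of B a unit lower triangular matrix,
so det R = 1 and the bound for rows with entries in [-1, 1] carries over. -/
theorem det_momentMatrix_le (h : Eliminated k U k M S) (T : ℕ → ℕ) (n : ℕ)
    (hT : ∀ x < n, T x < d) :
    (momentMatrix (arrayRow k M) T n).det ≤ k.factorial * (n : ℝ) ^ k := by
  obtain ⟨B, hB, hB₁, hB₀, hBM⟩ := h.factor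
  choose! r hr using hBM
  have hm : ∀ i < d, arrayRow k M i =
      arrayRow k B i ᵥ* (Matrix.of fun c b : Fin k => r b c) := by
    intro i hi
    ext b
    rw [arrayRow, hr b b.2 i hi, ← Fin.sum_univ_eq_sum_range (fun c => B i c * r b c)]
    rfl
  refine _root_.det_momentMatrix_le (B := arrayRow k B)
    (fun i hi c => hB i hi c c.2) ?_ hm T n hT
  have hBR : (Matrix.of fun a : Fin k => arrayRow k B (S a)) *
      (Matrix.of fun c b : Fin k => r b c) = 1 := by
    ext a b
    have := congrFun (hm (S a) (h.pivot_lt a a.2)) b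
    rw [h.arrayRow_pivot a.2] at this
    rw [Matrix.one_apply]
    refine this.symm.trans ?_
    rw [Pi.single_apply]
    simp [eq_comm]
  have hdet : (Matrix.of fun a : Fin k => arrayRow k B (S a)).det = 1 := by
    rw [det_of_isLowerTriangular]
    · exact Finset.prod_eq_one fun a _ => hB₁ a a.2
    · intro a c hac
      exact hB₀ a c hac c.2
  have := congrArg det hBR
  rwa [det_mul, hdet, one_mul, det_one] at this

/-- The k columns of M are independent members of a k-dimensional space, hence span it. -/
theorem exists_eq_dotProduct (h : Eliminated k U k M S) (hU : Module.finrank ℝ U = k) {u : Fin d → ℝ}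
    (hu : u ∈ U) : ∃ z : Fin k → ℝ, ∀ i : Fin d, u i = arrayRow k M i ⬝ᵥ z := by
  let f : Fin k → U := fun b => ⟨fun i => M i b, h.mem b b.2⟩
  have hf : LinearIndependent ℝ f := by
    rw [Fintype.linearIndependent_iff]
    intro z hz b
    have := h.indep (fun c => if hc : c < k then z ⟨c, hc⟩ else 0) (fun i hi => by
      have h₁ := congrFun (congrArg Subtype.val hz) ⟨i, hi⟩
      rw [← Fin.sum_univ_eq_sum_range
        (fun c => M i c * (if hc : c < k then z ⟨c, hc⟩ else 0))]
      simpa [f, mul_comm] using h₁) b b.2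
    simpa using this
  have htop := hf.span_eq_top_of_card_eq_finrank' (by simp [hU])
  have : (⟨u, hu⟩ : U) ∈ Submodule.span ℝ (Set.range f) := by rw [htop]; trivial
  obtain ⟨z, hz⟩ := (Submodule.mem_span_range_iff_exists_fun ℝ).mp this
  refine ⟨z, fun i => ?_⟩
  have h₁ := congrFun (congrArg Subtype.val hz) i
  simpa [f, dotProduct, arrayRow, mul_comm] using h₁.symm

theorem mem_of_dotProduct (h : Eliminated k U k M S) (z : Fin k → ℝ) :
    (fun i : Fin d => arrayRow k M i ⬝ᵥ z) ∈ U := by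
  have : (fun i : Fin d => arrayRow k M i ⬝ᵥ z) =
      ∑ b : Fin k, z b • fun i : Fin d => M i b := by
    ext i
    simp [dotProduct, arrayRow, mul_comm]
  rw [this]
  exact U.sum_mem fun b _ => U.smul_mem _ (h.mem b b.2)

end Eliminated

/-! ### Program fragments: inner products, row operations, pivot search -/

namespace RealRAM

/-- Real variable `0` receives the inner product of row `x` of array `a` with row `x'` of array
`a'`. -/
def dotProgram (a x a' x' : ℕ) : Program :=
  .seq (.setReal 0 (.ofNat (.const 0))) (.forLt 3 1 (.setReal 0 (.add (.var 0)
    (.mul (.get a (.var x) (.var 3)) (.get a' (.var x') (.var 3))))))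

theorem dotProgram_ends {a x a' x' k : ℕ} {s : State} (hk : s.natVar 1 = k) (hx : x ≠ 3)
    (hx' : x' ≠ 3) : Ends (dotProgram a x a' x') s (18 * k + 9) fun s' => s'.realVar 0 =
      arrayRow k (s.realArr a) (s.natVar x) ⬝ᵥ arrayRow k (s.realArr a') (s.natVar x') := by
  refine (Ends.seq (Ends.setReal (Ends.mono (Ends.forLt (x := 3) (y := 1) (n := k) (T := 10) (fun i s' => s'.realVar 0 =
    ∑ b ∈ Finset.range i, s.realArr a (s.natVar x) b * s.realArr a' (s.natVar x') b)
    hk (by decide) rfl rfl ?_ ?_) fun s' _ h => ?_))).le ?_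
  · simp [State.setReal, State.setNat, RealExpr.eval, NatExpr.eval]
  · intro i s' hi hF hi3 hI
    refine (Ends.setReal ?_)
    have h₁ : s'.natVar x = s.natVar x := hF.natVar x (by
      simp [Program.forLt, Program.writesNat, hx])
    have h₂ : s'.natVar x' = s.natVar x' := hF.natVar x' (by
      simp [Program.forLt, Program.writesNat, hx'])
    have h₃ : s'.realArr = s.realArr := funext fun a => hF.realArr a rfl
    simp only [State.setReal, State.setNat, RealExpr.eval, NatExpr.eval, if_true]
    rw [Finset.sum_range_succ, hI, h₁, h₂, h₃, hi3]
  · rw [h, ← Fin.sum_univ_eq_sum_range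
      fun b => s.realArr a (s.natVar x) b * s.realArr a' (s.natVar x') b]
    rfl
  · simp only [RealExpr.cost, NatExpr.cost]
    omega

/-- The first `k` entries of row `x` of array `a` are set to `e`, which may depend on the column
number in natural-number variable `3`. -/
def fillRow (a x : ℕ) (e : RealExpr) : Program :=
  .forLt 3 1 (.putReal a (.var x) (.var 3) e)

/-- When column b is computed, the columns from b on and all other rows still hold their old values;
this lets `e` refer to the row being overwritten. -/
theorem fillRow_ends {a x k p : ℕ} {e : RealExpr} {s : State} (hk : s.natVar 1 = k)
    (hp : s.natVar x = p) (hx : x ≠ 3) (F : ℕ → ℝ)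
    (he : ∀ b < k, ∀ s', (fillRow a x e).Frame s s' → s'.natVar 3 = b →
      (∀ i j, i ≠ p ∨ b ≤ j → s'.realArr a i j = s.realArr a i j) → e.eval s' = F b) :
    Ends (fillRow a x e) s (k * (e.cost + 11) + 6) fun s' => (∀ j < k, s'.realArr a p j = F j) ∧
      ∀ i j, i ≠ p ∨ k ≤ j → s'.realArr a i j = s.realArr a i j := by
  refine (Ends.forLt (n := k) (T := e.cost + 3) (fun b s' => (∀ j < b, s'.realArr a p j = F j) ∧
      ∀ i j, i ≠ p ∨ b ≤ j → s'.realArr a i j = s.realArr a i j) hk (by decide) rfl rfl ?_ ?_)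
  · simp [State.setNat]
  · rintro b s' hb hF hb3 ⟨hI, hI'⟩
    have h₁ : s'.natVar x = p := by
      rw [← hp]
      exact hF.natVar x (by simp [Program.forLt, Program.writesNat, hx])
    have h₂ := he b hb s' hF hb3 hI'
    refine (Ends.putReal ?_).le ?_
    · simp only [State.putReal, State.setNat, NatExpr.eval, true_and, h₁, h₂, hb3]
      refine ⟨fun j hj => ?_, fun i j hij => ?_⟩
      · rcases Nat.lt_succ_iff_lt_or_eq.mp hj with hj | rfl
        · rw [if_neg hj.ne, hI j hj]
        · rw [if_pos rfl]
      · rw [if_neg (by omega), hI' i j (by omega)]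
    · simp only [NatExpr.cost]
      omega

/-- The rank-one update of array `2` by its row number `p` (held in natural-number variable `5`);
the expression `e` for the coefficient may use real variable `0`, which holds the inner product of
the rows numbered `p` of the arrays `0` and `2`. -/
def rankOneProgram (e : RealExpr) : Program :=
  -- Row p is saved in array 3 because the loop below overwrites it in array 2 on reaching row p.
  .seq (fillRow 3 5 (.get 2 (.var 5) (.var 3))) <|
  .seq (dotProgram 0 5 3 5) <|
  .seq (.setReal 1 e) <|
  .forLt 4 0 <|
    .seq (dotProgram 0 4 3 5) <|
    .seq (.setReal 0 (.mul (.var 1) (.var 0))) <|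
    fillRow 2 4 (.sub (.get 2 (.var 4) (.var 3)) (.mul (.var 0) (.get 3 (.var 5) (.var 3))))

theorem rankOneProgram_ends {d k p : ℕ} {e : RealExpr} {s : State} {M Y : ℕ → ℕ → ℝ} {c : ℝ}
    (hd : s.natVar 0 = d) (hk : s.natVar 1 = k) (hp : s.natVar 5 = p)
    (hM : s.realArr 0 = M) (hY : s.realArr 2 = Y)
    (he : ∀ s', s'.realVar 0 = arrayRow k M p ⬝ᵥ arrayRow k Y p → e.eval s' = c) :
    Ends (rankOneProgram e) s (d * (38 * k + 28) + 32 * k + e.cost + 28) fun s' =>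
      ∀ i < d, arrayRow k (s'.realArr 2) i =
        arrayRow k Y i - (c * (arrayRow k M i ⬝ᵥ arrayRow k Y p)) • arrayRow k Y p := by
  refine (Ends.bind (fillRow_ends hk hp (by decide) (fun b => Y p b) ?_) fun s₁ hF₁ h₁ =>
    Ends.bind (T' := (e.cost + 1) + (d * (38 * k + 28) + 6))
    (dotProgram_ends (k := k) ?_ (by decide) (by decide)) fun s₂ hF₂ h₂ =>
    Ends.seq (Ends.setReal ?_)).le ?_
  · intro b hb s' hF hb3 _
    simp only [RealExpr.eval, NatExpr.eval]
    rw [hF.realArr 2 rfl, hF.natVar 5 rfl, hb3, hY, hp]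
  · rw [hF₁.natVar 1 rfl, hk]
  · have hT : arrayRow k (s₁.realArr 3) p = arrayRow k Y p := by
      ext b
      exact h₁.1 b b.2
    have hg : s₂.realVar 0 = arrayRow k M p ⬝ᵥ arrayRow k Y p := by
      rw [h₂, hF₁.natVar 5 rfl, hp, hT, hF₁.realArr 0 rfl, hM]
    rw [he s₂ hg]
    set s₃ := s₂.setReal 1 c with hs₃
    have hd₃ : s₃.natVar 0 = d := by
      rw [hs₃]
      simp only [State.setReal]
      rw [hF₂.natVar 0 rfl, hF₁.natVar 0 rfl, hd]
    have hk₃ : s₃.natVar 1 = k := by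
      rw [hs₃]
      simp only [State.setReal]
      rw [hF₂.natVar 1 rfl, hF₁.natVar 1 rfl, hk]
    have hp₃ : s₃.natVar 5 = p := by
      rw [hs₃]
      simp only [State.setReal]
      rw [hF₂.natVar 5 rfl, hF₁.natVar 5 rfl, hp]
    have hM₃ : s₃.realArr 0 = M := by
      rw [hs₃]
      simp only [State.setReal]
      rw [hF₂.realArr 0 rfl, hF₁.realArr 0 rfl, hM]
    have hY₃ : s₃.realArr 2 = Y := by
      rw [hs₃]
      simp only [State.setReal]
      rw [hF₂.realArr 2 rfl, hF₁.realArr 2 rfl, hY]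
    have hT₃ : arrayRow k (s₃.realArr 3) p = arrayRow k Y p := by
      rw [hs₃]
      simp only [State.setReal]
      rw [hF₂.realArr 3 rfl, hT]
    have hc₃ : s₃.realVar 1 = c := by simp [hs₃, State.setReal]
    refine (Ends.forLt (n := d) (T := 38 * k + 20) (fun x s' => ∀ i, arrayRow k (s'.realArr 2) i =
      if i < x then arrayRow k Y i - (c * (arrayRow k M i ⬝ᵥ arrayRow k Y p)) • arrayRow k Y p
      else arrayRow k Y i) hd₃ (by decide) rfl rfl ?_ ?_).mono ?_
    · intro i
      simp [State.setNat, hY₃]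
    · intro x s₄ hx hF₄ hx4 hI
      refine (Ends.bind (dotProgram_ends (k := k) ?_ (by decide) (by decide)) fun s₅ hF₅ h₅ =>
        Ends.seq (Ends.setReal ((fillRow_ends (k := k) (p := x) ?_ ?_ (by decide) (fun b => s₄.realArr 2 x b -
          (c * (arrayRow k M x ⬝ᵥ arrayRow k Y p)) * s₃.realArr 3 p b) ?_).mono ?_))).le ?_
      · rw [hF₄.natVar 1 rfl, hk₃]
      · simp only [State.setReal]
        rw [hF₅.natVar 1 rfl, hF₄.natVar 1 rfl, hk₃]
      · simp only [State.setReal]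
        rw [hF₅.natVar 4 rfl, hx4]
      · intro b hb s₆ hF₆ hb3 hold
        have h2 := hold x b (Or.inr le_rfl)
        have h4 := hF₆.natVar 4 rfl
        have h0 := hF₆.realVar 0 rfl
        have h3 := hF₆.realArr 3 rfl
        have h5 := hF₆.natVar 5 rfl
        simp only [RealExpr.eval, NatExpr.eval, State.setReal, if_true] at h2 h4 h0 h3 h5 ⊢
        rw [h5, h4, h3, h0, hb3, hF₅.natVar 4 rfl, hx4, h2, hF₅.realArr 2 rfl, hF₅.realArr 3 rfl,
          hF₄.realArr 3 rfl, hF₅.natVar 5 rfl, hF₄.natVar 5 rfl, hp₃, h₅, hx4, hF₄.natVar 5 rfl,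
          hp₃, hF₄.realArr 3 rfl, hT₃, hF₄.realArr 0 rfl, hM₃, hF₅.realVar 1 rfl,
          hF₄.realVar 1 rfl, hc₃]
      · intro s₆ hF₆ h₆ i
        simp only [State.setReal] at h₆
        simp only [State.setNat]
        by_cases hix : i = x
        · rw [hix, if_pos (Nat.lt_succ_self x)]
          ext b
          rw [arrayRow, h₆.1 b b.2]
          have h₇ := congrFun (hI x) b
          rw [if_neg (lt_irrefl x), arrayRow] at h₇
          have h₈ := congrFun hT₃ b
          rw [arrayRow] at h₈
          rw [h₇, h₈]
          rfl
        · have h₇ : arrayRow k (s₆.realArr 2) i = arrayRow k (s₄.realArr 2) i := by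
            ext b
            rw [arrayRow, h₆.2 i b (Or.inl hix), hF₅.realArr 2 rfl, arrayRow]
          rw [h₇, hI]
          exact if_congr (by omega) rfl rfl
      · simp only [RealExpr.cost, NatExpr.cost]
        omega
    · intro s' _ h i hi
      rw [h i, if_pos hi]
  · simp only [RealExpr.cost, NatExpr.cost]
    ring_nf
    omega

/-- The natural-number variable `5` receives the row number of the largest entry, in absolute
value, of column number `j` of array `0` (with `j` in natural-number variable `6`). -/
def findPivot : Program :=
  .seq (.setNat 5 (.const 0)) <|
  .forLt 4 0 <| .cond (.realLt
      (.mul (.get 0 (.var 5) (.var 6)) (.get 0 (.var 5) (.var 6)))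
      (.mul (.get 0 (.var 4) (.var 6)) (.get 0 (.var 4) (.var 6))))
    (.setNat 5 (.var 4)) .skip

theorem findPivot_ends {d j : ℕ} {s : State} {M : ℕ → ℕ → ℝ} (hd : s.natVar 0 = d) (hd₀ : 0 < d)
    (hj : s.natVar 6 = j) (hM : s.realArr 0 = M) :
    Ends findPivot s (d * 27 + 8) fun s' => s'.natVar 5 < d ∧
      ∀ i < d, M i j ^ 2 ≤ M (s'.natVar 5) j ^ 2 := by
  refine (Ends.seq (Ends.setNat (Ends.forLt (n := d) (T := 19) (fun x s' => s'.natVar 5 < d ∧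
      ∀ i < x, M i j ^ 2 ≤ M (s'.natVar 5) j ^ 2) ?_ (by decide) rfl rfl ?_ ?_))).le ?_
  · simpa [State.setNat] using hd
  · simpa [State.setNat, NatExpr.eval] using hd₀
  · rintro x s' hx hF hx4 ⟨h5, hI⟩
    have h6 : s'.natVar 6 = j := by
      rw [hF.natVar 6 rfl]
      exact hj
    have h0 : s'.realArr 0 = M := by
      rw [hF.realArr 0 rfl]
      exact hM
    refine (Ends.cond (fun hb => Ends.setNat ?_) (fun hb => Ends.skip ?_)).le ?_
    · simp only [Test.Holds, RealExpr.eval, NatExpr.eval, h0, h6, hx4] at hb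
      simp only [State.setNat, NatExpr.eval, hx4]
      refine ⟨by simpa using hx, fun i hi => ?_⟩
      rcases Nat.lt_succ_iff_lt_or_eq.mp hi with hi | rfl
      · have := hI i hi
        simp only [Nat.reduceEqDiff, if_false, if_true]
        nlinarith
      · simp
    · simp only [Test.Holds, RealExpr.eval, NatExpr.eval, h0, h6, hx4, not_lt] at hb
      simp only [State.setNat, Nat.reduceEqDiff, if_false]
      refine ⟨h5, fun i hi => ?_⟩
      rcases Nat.lt_succ_iff_lt_or_eq.mp hi with hi | rfl
      · exact hI i hi
      · rwa [sq, sq]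
    · simp only [Test.cost, RealExpr.cost, NatExpr.cost]
      omega
  · simp only [NatExpr.cost]
    omega

end RealRAM

/-! ### Insertion and removal of rows in the dual array -/

/-- The rows `y i` of the array `Y` are `m iᵀ V⁻¹`, where `m i` are the rows of `M` and `V` is the
moment matrix of the rows of `M` listed by `S`. -/
structure IsDualArray (d k : ℕ) (M Y : ℕ → ℕ → ℝ) (S : ℕ → ℕ) (n : ℕ) : Prop where
  lt : ∀ x < n, S x < d
  vecMul : ∀ i < d, arrayRow k Y i ᵥ* momentMatrix (arrayRow k M) S n = arrayRow k M i

namespace IsDualArray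

variable {d k n : ℕ} {M Y Y' : ℕ → ℕ → ℝ} {S S' : ℕ → ℕ}

theorem leverage_nonneg (h : IsDualArray d k M Y S n) {p : ℕ} (hp : p < d) :
    0 ≤ arrayRow k M p ⬝ᵥ arrayRow k Y p :=
  dotProduct_nonneg_of_vecMul_momentMatrix (h.vecMul p hp)

/-- Sherman–Morrison and the determinant lemma with σ = 1; the denominator is positive because
leverages are nonnegative. -/
theorem insert (h : IsDualArray d k M Y S n)
    (hdet : (momentMatrix (arrayRow k M) S n).det ≠ 0) {p : ℕ} (hp : p < d)
    (hS : ∀ x < n, S' x = S x) (hSn : S' n = p)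
    (hY : ∀ i < d, arrayRow k Y' i = arrayRow k Y i -
      (1 / (1 + arrayRow k M p ⬝ᵥ arrayRow k Y p) * (arrayRow k M i ⬝ᵥ arrayRow k Y p)) •
        arrayRow k Y p) :
    IsDualArray d k M Y' S' (n + 1) ∧ (momentMatrix (arrayRow k M) S' (n + 1)).det =
      (momentMatrix (arrayRow k M) S n).det * (1 + arrayRow k M p ⬝ᵥ arrayRow k Y p) := by
  have hg := h.leverage_nonneg hp
  have hV : momentMatrix (arrayRow k M) S' (n + 1) = momentMatrix (arrayRow k M) S n +
      (1 : ℝ) • vecMulVec (arrayRow k M p) (arrayRow k M p) := by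
    rw [momentMatrix_succ, momentMatrix_congr hS, hSn, one_smul]
  refine ⟨⟨fun x hx => ?_, fun i hi => ?_⟩, ?_⟩
  · rcases Nat.lt_succ_iff_lt_or_eq.mp hx with hx | rfl
    · rw [hS x hx]
      exact h.lt x hx
    · rwa [hSn]
  · rw [hV, hY i hi]
    refine vecMul_rankOne_update (momentMatrix_transpose _ _ _) (h.vecMul i hi) (h.vecMul p hp) ?_
    rw [one_mul, one_div, inv_mul_cancel₀ (by positivity)]
  · rw [hV, det_rankOne_update hdet (h.vecMul p hp), one_mul]

/-- The same with σ = -1. Leverage 1 must be excluded, since the determinant would then drop to 0.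
-/
theorem remove (h : IsDualArray d k M Y S (n + 1))
    (hdet : (momentMatrix (arrayRow k M) S (n + 1)).det ≠ 0) {q : ℕ} (hq : q ≤ n)
    (hg : arrayRow k M (S q) ⬝ᵥ arrayRow k Y (S q) ≠ 1)
    (hS : ∀ x < n, S' x = if x = q then S n else S x)
    (hY : ∀ i < d, arrayRow k Y' i = arrayRow k Y i -
      (1 / (arrayRow k M (S q) ⬝ᵥ arrayRow k Y (S q) - 1) *
        (arrayRow k M i ⬝ᵥ arrayRow k Y (S q))) • arrayRow k Y (S q)) :
    IsDualArray d k M Y' S' n ∧ (momentMatrix (arrayRow k M) S' n).det =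
      (momentMatrix (arrayRow k M) S (n + 1)).det *
        (1 - arrayRow k M (S q) ⬝ᵥ arrayRow k Y (S q)) := by
  have hqd := h.lt q (Nat.lt_succ_of_le hq)
  have hV : momentMatrix (arrayRow k M) S' n = momentMatrix (arrayRow k M) S (n + 1) +
      (-1 : ℝ) • vecMulVec (arrayRow k M (S q)) (arrayRow k M (S q)) := by
    rw [momentMatrix_swap hq hS, neg_one_smul, sub_eq_add_neg]
  refine ⟨⟨fun x hx => ?_, fun i hi => ?_⟩, ?_⟩
  · rw [hS x hx]
    split_ifs
    · exact h.lt n (Nat.lt_succ_self n)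
    · exact h.lt x (Nat.lt_succ_of_lt hx)
  · rw [hV, hY i hi]
    refine vecMul_rankOne_update (momentMatrix_transpose _ _ _) (h.vecMul i hi)
      (h.vecMul _ hqd) ?_
    have := sub_ne_zero.mpr hg
    field_simp
    ring
  · rw [hV, det_rankOne_update hdet (h.vecMul _ hqd)]
    ring

theorem sum_leverage (h : IsDualArray d k M Y S n)
    (hdet : (momentMatrix (arrayRow k M) S n).det ≠ 0) :
    ∑ x ∈ Finset.range n, arrayRow k M (S x) ⬝ᵥ arrayRow k Y (S x) = k :=
  sum_dotProduct_of_vecMul_momentMatrix hdet fun x hx => h.vecMul _ (h.lt x hx)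

/-- The average leverage is k / (4k + 1) < 1/4. -/
theorem exists_leverage_le (h : IsDualArray d k M Y S (4 * k + 1))
    (hdet : (momentMatrix (arrayRow k M) S (4 * k + 1)).det ≠ 0) :
    ∃ x < 4 * k + 1, arrayRow k M (S x) ⬝ᵥ arrayRow k Y (S x) ≤ 1 / 4 := by
  by_contra! hcon
  have h₁ := Finset.card_nsmul_le_sum (Finset.range (4 * k + 1))
    (fun x => arrayRow k M (S x) ⬝ᵥ arrayRow k Y (S x)) (1 / 4)
    fun x hx => (hcon x (Finset.mem_range.mp hx)).le
  rw [h.sum_leverage hdet, Finset.card_range, nsmul_eq_mul] at h₁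
  push_cast at h₁
  linarith

end IsDualArray

/-- The pivot rows are the standard unit vectors, so four copies of them give V = 4I and Y = M / 4.
-/
theorem Eliminated.isDualArray {d k : ℕ} {U : Submodule ℝ (Fin d → ℝ)} {M Y : ℕ → ℕ → ℝ}
    {S S' : ℕ → ℕ} (h : Eliminated k U k M S) (hS : ∀ a < k, S' a = S a ∧ S' (a + k) = S a ∧
      S' (a + k + k) = S a ∧ S' (a + k + k + k) = S a)
    (hY : ∀ i < d, ∀ b < k, Y i b = M i b / 4) :
    IsDualArray d k M Y S' (4 * k) ∧ 1 ≤ (momentMatrix (arrayRow k M) S' (4 * k)).det := by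
  have hone : ∑ a ∈ Finset.range k, vecMulVec (arrayRow k M (S a)) (arrayRow k M (S a)) = 1 := by
    rw [← Fin.sum_univ_eq_sum_range
      fun a => vecMulVec (arrayRow k M (S a)) (arrayRow k M (S a))]
    ext b c
    rw [Matrix.sum_apply, Finset.sum_eq_single b]
    · rw [h.arrayRow_pivot b.2, vecMulVec_apply, Matrix.one_apply]
      simp [Pi.single_apply, eq_comm]
    · intro a _ ha
      rw [h.arrayRow_pivot a.2, vecMulVec_apply]
      simp [Pi.single_apply, ha.symm]
    · simp
  have hV : momentMatrix (arrayRow k M) S' (4 * k) = (4 : ℝ) • 1 := by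
    rw [momentMatrix, show 4 * k = k + k + k + k by ring, Finset.sum_range_add,
      Finset.sum_range_add, Finset.sum_range_add]
    have e : ∀ f : ℕ → ℕ, (∀ a < k, S' (f a) = S a) → ∑ a ∈ Finset.range k,
        vecMulVec (arrayRow k M (S' (f a))) (arrayRow k M (S' (f a))) = 1 := fun f hf => by
      rw [← hone]
      exact Finset.sum_congr rfl fun a ha => by rw [hf a (Finset.mem_range.mp ha)]
    rw [e (fun a => a) fun a ha => (hS a ha).1,
      e (fun a => k + a) fun a ha => by rw [← (hS a ha).2.1]; congr 1; ring,
      e (fun a => k + k + a) fun a ha => by rw [← (hS a ha).2.2.1]; congr 1; ring,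
      e (fun a => k + k + k + a) fun a ha => by rw [← (hS a ha).2.2.2]; congr 1; ring]
    module
  refine ⟨⟨fun x hx => ?_, fun i hi => ?_⟩, ?_⟩
  · by_cases h₁ : x < k
    · rw [(hS x h₁).1]
      exact h.pivot_lt _ h₁
    by_cases h₂ : x < 2 * k
    · rw [show x = (x - k) + k by omega, (hS (x - k) (by omega)).2.1]
      exact h.pivot_lt _ (by omega)
    by_cases h₃ : x < 3 * k
    · rw [show x = (x - k - k) + k + k by omega, (hS (x - k - k) (by omega)).2.2.1]
      exact h.pivot_lt _ (by omega)
    · rw [show x = (x - k - k - k) + k + k + k by omega,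
        (hS (x - k - k - k) (by omega)).2.2.2]
      exact h.pivot_lt _ (by omega)
  · rw [hV, vecMul_smul, vecMul_one]
    ext b
    rw [Pi.smul_apply, arrayRow, hY i hi b b.2, arrayRow, smul_eq_mul]
    ring
  · rw [hV, det_smul, det_one, mul_one]
    exact one_le_pow₀ (by norm_num)

/-! ### Programs for elimination and for the starting list -/

namespace RealRAM

/-- One step of the elimination: column number `j` (in natural-number variable `6`) of array `0`. -/
def eliminateColumn : Program :=
  .seq findPivot <|
  .seq (.setReal 0 (.get 0 (.var 5) (.var 6))) <|
  .seq (fillRow 3 5 (.get 0 (.var 5) (.var 3))) <|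
  .seq (.forLt 4 0 <|
    .seq (.setReal 1 (.div (.get 0 (.var 4) (.var 6)) (.var 0))) <|
    .seq (fillRow 0 4 (.sub (.get 0 (.var 4) (.var 3)) (.mul (.get 3 (.var 5) (.var 3)) (.var 1))))
      -- The preceding row operation leaves 0 in column j; the quotient is put there.
      (.putReal 0 (.var 4) (.var 6) (.var 1))) <|
  .putNat 0 (.var 6) (.var 5)

theorem eliminateColumn_ends {d k j : ℕ} {s : State} {M : ℕ → ℕ → ℝ} {S : ℕ → ℕ}
    (hd : s.natVar 0 = d) (hk : s.natVar 1 = k) (hj : s.natVar 6 = j) (hd₀ : 0 < d)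
    (hM : s.realArr 0 = M) (hS : s.natArr 0 = S) :
    Ends eliminateColumn s (20 * (d * k) + 51 * d + 14 * k + 27) fun s' =>
      ∃ p < d, (∀ i < d, M i j ^ 2 ≤ M p j ^ 2) ∧
        (∀ i < d, ∀ b < k, s'.realArr 0 i b =
          if b = j then M i j / M p j else M i b - M p b * (M i j / M p j)) ∧
        (∀ a < j, s'.natArr 0 a = S a) ∧ s'.natArr 0 j = p := by
  refine (Ends.bind (findPivot_ends hd hd₀ hj hM) (T' := 20 * (d * k) + 24 * d + 14 * k + 19)
    fun s₁ hF₁ h₁ => ?_).le (by omega)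
  obtain ⟨hp, hmax⟩ := h₁
  have hj₁ : s₁.natVar 6 = j := by rw [hF₁.natVar 6 rfl, hj]
  have hd₁ : s₁.natVar 0 = d := by rw [hF₁.natVar 0 rfl, hd]
  have hk₁ : s₁.natVar 1 = k := by rw [hF₁.natVar 1 rfl, hk]
  have hM₁ : s₁.realArr 0 = M := by rw [hF₁.realArr 0 rfl, hM]
  have hS₁ : s₁.natArr 0 = S := by rw [hF₁.natArr 0 rfl, hS]
  obtain ⟨p, hp₁⟩ : ∃ p, s₁.natVar 5 = p := ⟨_, rfl⟩
  rw [hp₁] at hp hmax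
  refine (Ends.seq (Ends.setReal ?_)).le (T := 4 + (20 * (d * k) + 24 * d + 14 * k + 15)) (by omega)
  simp only [RealExpr.eval, NatExpr.eval, hp₁, hj₁, hM₁]
  set s₂ := s₁.setReal 0 (M p j) with hs₂
  have hm₂ : s₂.realVar 0 = M p j := by simp [hs₂, State.setReal]
  refine (Ends.bind (fillRow_ends (k := k) (p := p) (s := s₂) hk₁ hp₁ (by decide)
    (fun b => M p b) ?_) (T' := 20 * (d * k) + 24 * d + 9) fun s₃ hF₃ h₃ => ?_).le ?_
  · intro b hb s' hF hb3 _
    simp only [RealExpr.eval, NatExpr.eval]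
    rw [hF.natVar 5 rfl, hF.realArr 0 rfl, hb3]
    change s₁.realArr 0 (s₁.natVar 5) b = _
    rw [hM₁, hp₁]
  · have hj₃ : s₃.natVar 6 = j := (hF₃.natVar 6 rfl).trans hj₁
    have hd₃ : s₃.natVar 0 = d := (hF₃.natVar 0 rfl).trans hd₁
    have hk₃ : s₃.natVar 1 = k := (hF₃.natVar 1 rfl).trans hk₁
    have hp₃ : s₃.natVar 5 = p := (hF₃.natVar 5 rfl).trans hp₁
    have hM₃ : s₃.realArr 0 = M := (hF₃.realArr 0 rfl).trans hM₁
    have hS₃ : s₃.natArr 0 = S := (hF₃.natArr 0 rfl).trans hS₁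
    have hm₃ : s₃.realVar 0 = M p j := (hF₃.realVar 0 rfl).trans hm₂
    refine (Ends.bind (Ends.forLt (x := 4) (y := 0) (n := d) (T := 20 * k + 16)
      (fun x s' => (∀ i < x, ∀ b < k, s'.realArr 0 i b =
          if b = j then M i j / M p j else M i b - M p b * (M i j / M p j)) ∧
        ∀ i, x ≤ i → ∀ b, s'.realArr 0 i b = M i b) hd₃ (by decide) rfl rfl ?_ ?_)
      (T' := 3) fun s₄ hF₄ h₄ => Ends.putNat ?_).le ?_
    · simp [State.setNat, hM₃]
    · rintro x s₅ hx hF₅ hx5 ⟨hI, hI'⟩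
      have hj₅ : s₅.natVar 6 = j := (hF₅.natVar 6 rfl).trans hj₃
      have hk₅ : s₅.natVar 1 = k := (hF₅.natVar 1 rfl).trans hk₃
      have hp₅ : s₅.natVar 5 = p := (hF₅.natVar 5 rfl).trans hp₃
      have hm₅ : s₅.realVar 0 = M p j := (hF₅.realVar 0 rfl).trans hm₃
      have hT₅ : ∀ b < k, s₅.realArr 3 p b = M p b := fun b hb => by
        rw [hF₅.realArr 3 rfl, h₃.1 b hb]
      refine (Ends.seq (T' := 20 * k + 10) (Ends.setReal ?_)).le ?_
      · simp only [RealExpr.eval, NatExpr.eval, hx5, hj₅, hm₅, hI' x le_rfl]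
        refine (Ends.bind (T' := 4) (fillRow_ends (k := k) (p := x) (by exact hk₅) (by exact hx5)
          (by decide) (fun b => M x b - M p b * (M x j / M p j)) ?_) fun s₆ hF₆ h₆ =>
          Ends.putReal ?_).le ?_
        · intro b hb s' hF hb3 hold
          simp only [RealExpr.eval, NatExpr.eval]
          rw [hF.natVar 4 rfl, hF.realArr 3 rfl, hF.natVar 5 rfl, hF.realVar 1 rfl, hb3]
          simp only [State.setReal, if_true]
          rw [hx5, hp₅, hT₅ b hb, hold x b (Or.inr le_rfl)]
          simp only [State.setReal]
          rw [hI' x le_rfl]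
        · have h4 : s₆.natVar 4 = x := (hF₆.natVar 4 rfl).trans hx5
          have h6 : s₆.natVar 6 = j := (hF₆.natVar 6 rfl).trans hj₅
          have hr : s₆.realVar 1 = M x j / M p j := by
            rw [hF₆.realVar 1 rfl]
            simp [State.setReal]
          simp only [State.setNat, State.putReal, RealExpr.eval, NatExpr.eval, h4, h6, hr,
            true_and]
          refine ⟨fun i hi b hb => ?_, fun i hi b => ?_⟩
          · by_cases hix : i = x
            · subst hix
              by_cases hbj : b = j
              · simp [hbj]
              · simp only [true_and, if_neg hbj]
                exact h₆.1 b hb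
            · rw [if_neg (fun h => hix h.1), h₆.2 i b (Or.inl hix)]
              exact hI i (by omega) b hb
          · rw [if_neg (by omega), h₆.2 i b (Or.inl (by omega))]
            exact hI' i (by omega) b
        · simp only [RealExpr.cost, NatExpr.cost]
          omega
      · simp only [RealExpr.cost, NatExpr.cost]
        omega
    · have h6 : s₄.natVar 6 = j := (hF₄.natVar 6 rfl).trans hj₃
      have h5 : s₄.natVar 5 = p := (hF₄.natVar 5 rfl).trans hp₃
      have hS₄ : s₄.natArr 0 = S := (hF₄.natArr 0 rfl).trans hS₃
      refine ⟨p, hp, hmax, h₄.1, fun a ha => ?_, ?_⟩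
      · simp [State.putNat, NatExpr.eval, h6, ha.ne, hS₄]
      · simp [State.putNat, NatExpr.eval, h6, h5]
    · linarith
  · simp only [RealExpr.cost, NatExpr.cost]
    omega

/-- Gauss–Jordan elimination of the columns of array `0`, listing the pivot rows in the array `0` of
natural numbers. -/
def eliminateColumns : Program := .forLt 6 1 eliminateColumn

theorem eliminateColumns_ends {d k : ℕ} {s : State} {U : Submodule ℝ (Fin d → ℝ)}
    (hd : s.natVar 0 = d) (hk : s.natVar 1 = k) (hd₀ : 0 < d)
    (h : Eliminated k U 0 (s.realArr 0) (s.natArr 0)) :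
    Ends eliminateColumns s (k * (20 * (d * k) + 51 * d + 14 * k + 35) + 6) fun s' =>
      Eliminated k U k (s'.realArr 0) (s'.natArr 0) := by
  refine Ends.forLt (n := k) (T := 20 * (d * k) + 51 * d + 14 * k + 27)
    (fun j s' => Eliminated k U j (s'.realArr 0) (s'.natArr 0)) hk (by decide) rfl rfl h ?_
  intro j s' hj hF hj6 hI
  refine (eliminateColumn_ends ((hF.natVar 0 rfl).trans hd) ((hF.natVar 1 rfl).trans hk) hj6 hd₀
    rfl rfl).mono ?_
  rintro s'' _ ⟨p, hp, hmax, hM, hS, hSj⟩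
  exact hI.step hj hp hmax hM hS hSj

/-- Lists every pivot row four times and puts a quarter of array `0` into array `2`. -/
def startProgram : Program :=
  .seq (.setNat 2 (.add (.add (.add (.var 1) (.var 1)) (.var 1)) (.var 1))) <|
  .seq (.forLt 3 1 <|
    .seq (.putNat 0 (.add (.var 3) (.var 1)) (.get 0 (.var 3))) <|
    .seq (.putNat 0 (.add (.add (.var 3) (.var 1)) (.var 1)) (.get 0 (.var 3))) <|
    .putNat 0 (.add (.add (.add (.var 3) (.var 1)) (.var 1)) (.var 1)) (.get 0 (.var 3))) <|
  .forLt 4 0 <| fillRow 2 4 (.div (.get 0 (.var 4) (.var 3)) (.ofNat (.const 4)))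

theorem startProgram_ends {d k : ℕ} {s : State} {M : ℕ → ℕ → ℝ} {S : ℕ → ℕ}
    (hd : s.natVar 0 = d) (hk : s.natVar 1 = k) (hM : s.realArr 0 = M) (hS : s.natArr 0 = S) :
    Ends startProgram s (d * (17 * k + 14) + 32 * k + 20) fun s' => s'.natVar 2 = 4 * k ∧
      (∀ a < k, s'.natArr 0 a = S a ∧ s'.natArr 0 (a + k) = S a ∧
        s'.natArr 0 (a + k + k) = S a ∧ s'.natArr 0 (a + k + k + k) = S a) ∧
      ∀ i < d, ∀ b < k, s'.realArr 2 i b = M i b / 4 := by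
  refine (Ends.seq (T' := d * (17 * k + 14) + 32 * k + 12) (Ends.setNat ?_)).le ?_
  · refine (Ends.bind (Ends.forLt (x := 3) (y := 1) (n := k) (T := 24)
      (fun x s' => (∀ a < k, s'.natArr 0 a = S a) ∧ ∀ a < x, s'.natArr 0 (a + k) = S a ∧
        s'.natArr 0 (a + k + k) = S a ∧ s'.natArr 0 (a + k + k + k) = S a)
      (by exact hk) (by decide) rfl rfl ?_ ?_) (T' := d * (17 * k + 14) + 6)
      fun s₁ hF₁ h₁ => ?_).le ?_
    · simp [State.setNat, hS]
    · rintro x s' hx hF hx3 ⟨hI, hI'⟩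
      have hk' : s'.natVar 1 = k := (hF.natVar 1 rfl).trans hk
      refine (Ends.seq (Ends.putNat (Ends.seq (Ends.putNat (Ends.putNat ?_))))).le ?_
      · simp only [State.putNat, State.setNat, NatExpr.eval, hx3, hk', true_and]
        refine ⟨fun a ha => ?_, fun a ha => ?_⟩
        · rw [if_neg (by omega), if_neg (by omega), if_neg (by omega), hI a ha]
        · rw [if_neg (show x ≠ x + k + k by omega), if_neg (show x ≠ x + k by omega), hI x hx]
          rcases Nat.lt_succ_iff_lt_or_eq.mp ha with ha | rfl
          · obtain ⟨h1, h2, h3⟩ := hI' a ha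
            refine ⟨?_, ?_, ?_⟩
            · rw [if_neg (by omega), if_neg (by omega), if_neg (by omega), h1]
            · rw [if_neg (by omega), if_neg (by omega), if_neg (by omega), h2]
            · rw [if_neg (by omega), if_neg (by omega), if_neg (by omega), h3]
          · refine ⟨?_, ?_, ?_⟩
            · rw [if_neg (by omega), if_neg (by omega), if_pos rfl]
            · rw [if_neg (by omega), if_pos rfl]
            · rw [if_pos rfl]
      · simp [NatExpr.cost]
    · have hd₁ : s₁.natVar 0 = d := (hF₁.natVar 0 rfl).trans hd
      have hk₁ : s₁.natVar 1 = k := (hF₁.natVar 1 rfl).trans hk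
      have hM₁ : s₁.realArr 0 = M := (hF₁.realArr 0 rfl).trans hM
      have hn₁ : s₁.natVar 2 = 4 * k := by
        rw [hF₁.natVar 2 rfl]
        simp only [State.setNat, NatExpr.eval, if_true, hk]
        ring
      refine (Ends.forLt (x := 4) (y := 0) (n := d) (T := 17 * k + 6)
        (fun x s' => ∀ i < x, ∀ b < k, s'.realArr 2 i b = M i b / 4) hd₁ (by decide) rfl rfl
        (by simp) ?_).mono fun s₂ hF₂ h₂ => ⟨?_, ?_, h₂⟩
      · intro x s' hx hF hx4 hI
        refine ((fillRow_ends (k := k) (p := x) ((hF.natVar 1 rfl).trans hk₁) hx4 (by decide)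
          (fun b => M x b / 4) ?_).mono fun s'' hF' h => ?_).le ?_
        · intro b hb s'' hF' hb3 _
          simp only [RealExpr.eval, NatExpr.eval]
          rw [hF'.natVar 4 rfl, hx4, hb3, hF'.realArr 0 rfl, hF.realArr 0 rfl, hM₁]
          norm_num
        · intro i hi b hb
          simp only [State.setNat]
          rcases Nat.lt_succ_iff_lt_or_eq.mp hi with hi | rfl
          · rw [h.2 i b (Or.inl hi.ne), hI i hi b hb]
          · exact h.1 b hb
        · simp only [RealExpr.cost, NatExpr.cost]
          omega
      · rw [hF₂.natVar 2 rfl, hn₁]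
      · intro a ha
        rw [hF₂.natArr 0 rfl]
        exact ⟨h₁.1 a ha, h₁.2 a ha⟩
    · omega
  · simp only [NatExpr.cost]
    omega

end RealRAM

/-! ### Programs for the exchanges and the output -/

namespace RealRAM

/-- Natural-number variable `7` receives `i + 1` for some row number `i` of leverage above `1 / 2`,
and `0` if there is none. -/
def findLargeLeverage : Program :=
  .seq (.setNat 7 (.const 0)) <|
  .forLt 4 0 <|
    .seq (dotProgram 0 4 2 4) <|
    .cond (.realLt (.ofNat (.const 1)) (.add (.var 0) (.var 0)))
      (.setNat 7 (.add (.var 4) (.const 1))) .skip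

theorem findLargeLeverage_ends {d k : ℕ} {s : State} {M Y : ℕ → ℕ → ℝ} (hd : s.natVar 0 = d)
    (hk : s.natVar 1 = k) (hM : s.realArr 0 = M) (hY : s.realArr 2 = Y) :
    Ends findLargeLeverage s (d * (18 * k + 36) + 8) fun s' =>
      (s'.natVar 7 = 0 → ∀ i < d, arrayRow k M i ⬝ᵥ arrayRow k Y i ≤ 1 / 2) ∧
      ∀ p, s'.natVar 7 = p + 1 → p < d ∧ 1 / 2 < arrayRow k M p ⬝ᵥ arrayRow k Y p := by
  refine (Ends.seq (T' := d * (18 * k + 36) + 6) (Ends.setNat ?_)).le ?_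
  · refine (Ends.forLt (n := d) (T := 18 * k + 28) (fun x s' =>
      (s'.natVar 7 = 0 → ∀ i < x, arrayRow k M i ⬝ᵥ arrayRow k Y i ≤ 1 / 2) ∧
      ∀ p, s'.natVar 7 = p + 1 → p < d ∧ 1 / 2 < arrayRow k M p ⬝ᵥ arrayRow k Y p)
      (by exact hd) (by decide) rfl rfl ?_ ?_).le (le_of_eq (by ring))
    · simp [State.setNat, NatExpr.eval]
    · rintro x s₁ hx hF₁ hx₁ ⟨hI, hI'⟩
      have hM₁ : s₁.realArr 0 = M := (hF₁.realArr 0 rfl).trans hM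
      have hY₁ : s₁.realArr 2 = Y := (hF₁.realArr 2 rfl).trans hY
      refine (Ends.bind (T' := 18) (dotProgram_ends ((hF₁.natVar 1 rfl).trans hk) (by decide)
        (by decide)) fun s₂ hF₂ h₂ => (Ends.cond (fun hb => Ends.setNat ?_)
        (fun hb => Ends.skip ?_)).le ?_).le ?_
      · rw [hM₁, hY₁, hx₁] at h₂
        have hx₂ : s₂.natVar 4 = x := (hF₂.natVar 4 rfl).trans hx₁
        simp only [Test.Holds, RealExpr.eval, NatExpr.eval, h₂, Nat.cast_one] at hb
        simp only [State.setNat, NatExpr.eval, hx₂, if_true, Nat.reduceEqDiff, if_false]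
        refine ⟨fun h => h.elim, fun p hp => ?_⟩
        obtain rfl := hp
        exact ⟨hx, by linarith⟩
      · rw [hM₁, hY₁, hx₁] at h₂
        simp only [Test.Holds, RealExpr.eval, NatExpr.eval, h₂, Nat.cast_one] at hb
        simp only [State.setNat, Nat.reduceEqDiff, if_false, hF₂.natVar 7 rfl]
        refine ⟨fun h i hi => ?_, hI'⟩
        rcases Nat.lt_succ_iff_lt_or_eq.mp hi with hi | rfl
        · exact hI h i hi
        · linarith
      · simp [Test.cost, RealExpr.cost, NatExpr.cost]
      · omega
  · simp only [NatExpr.cost]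
    omega

/-- Natural-number variable `9` receives a position in the list (whose length is in natural-number
variable `8`) of a row of leverage at most `1 / 4`. -/
def findSmallLeverage : Program :=
  .forLt 6 8 <|
    .seq (.setNat 5 (.get 0 (.var 6))) <|
    .seq (dotProgram 0 5 2 5) <|
    .cond (.realLt (.ofNat (.const 1)) (.mul (.ofNat (.const 4)) (.var 0)))
      .skip (.setNat 9 (.var 6))

theorem findSmallLeverage_ends {k n : ℕ} {s : State} {M Y : ℕ → ℕ → ℝ} {S : ℕ → ℕ}
    (hk : s.natVar 1 = k) (hn : s.natVar 8 = n) (hM : s.realArr 0 = M) (hY : s.realArr 2 = Y)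
    (hS : s.natArr 0 = S)
    (h : ∃ x < n, arrayRow k M (S x) ⬝ᵥ arrayRow k Y (S x) ≤ 1 / 4) :
    Ends findSmallLeverage s (n * (18 * k + 36) + 6) fun s' =>
      s'.natVar 9 < n ∧
        arrayRow k M (S (s'.natVar 9)) ⬝ᵥ arrayRow k Y (S (s'.natVar 9)) ≤ 1 / 4 := by
  -- The invariant is an implication because variable 9 holds an arbitrary leftover value until a
  -- suitable position is met.
  refine (Ends.forLt (n := n) (T := 18 * k + 28) (fun y s' =>
    (∃ x < y, arrayRow k M (S x) ⬝ᵥ arrayRow k Y (S x) ≤ 1 / 4) → s'.natVar 9 < n ∧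
        arrayRow k M (S (s'.natVar 9)) ⬝ᵥ arrayRow k Y (S (s'.natVar 9)) ≤ 1 / 4)
    hn (by decide) rfl rfl ?_ ?_).mono fun s' _ h' => h' h
  · rintro ⟨x, hx, _⟩
    omega
  · intro y s₁ hy hF₁ hy₁ hI
    have hM₁ : s₁.realArr 0 = M := (hF₁.realArr 0 rfl).trans hM
    have hY₁ : s₁.realArr 2 = Y := (hF₁.realArr 2 rfl).trans hY
    have hS₁ : s₁.natArr 0 = S := (hF₁.natArr 0 rfl).trans hS
    refine (Ends.seq (T' := 18 * k + 25) (Ends.setNat ?_)).le ?_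
    · simp only [NatExpr.eval, hS₁, hy₁]
      refine (Ends.bind (T' := 16) (dotProgram_ends (a := 0) (x := 5) (a' := 2) (x' := 5) (k := k)
        (s := s₁.setNat 5 (S y)) ((hF₁.natVar 1 rfl).trans hk)
        (by decide) (by decide)) fun s₂ hF₂ h₂ => (Ends.cond (fun hb => Ends.skip ?_)
        (fun hb => Ends.setNat ?_)).le ?_).le ?_
      · simp only [State.setNat, if_true] at h₂
        rw [hM₁, hY₁] at h₂
        simp only [Test.Holds, RealExpr.eval, NatExpr.eval, h₂, Nat.cast_one,
          Nat.cast_ofNat] at hb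
        rintro ⟨x, hx, hle⟩
        have h9 : s₂.natVar 9 = s₁.natVar 9 := hF₂.natVar 9 rfl
        simp only [State.setNat, Nat.reduceEqDiff, if_false, h9]
        rcases Nat.lt_succ_iff_lt_or_eq.mp hx with hx | rfl
        · exact hI ⟨x, hx, hle⟩
        · linarith
      · simp only [State.setNat, if_true] at h₂
        rw [hM₁, hY₁] at h₂
        simp only [Test.Holds, RealExpr.eval, NatExpr.eval, h₂, Nat.cast_one,
          Nat.cast_ofNat] at hb
        have h6 : s₂.natVar 6 = y := (hF₂.natVar 6 rfl).trans hy₁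
        intro _
        simp only [State.setNat, NatExpr.eval, Nat.reduceEqDiff, if_false, if_true, h6]
        exact ⟨hy, by linarith⟩
      · simp [Test.cost, RealExpr.cost, NatExpr.cost]
      · omega
    · simp only [NatExpr.cost]
      omega

/-- Appends to the list the row whose number plus one is in natural-number variable `7`, and removes
from the list a row of small leverage. -/
def exchangeProgram : Program :=
  .seq (.setNat 5 (.sub (.var 7) (.const 1))) <|
  .seq (.putNat 0 (.var 2) (.var 5)) <|
  .seq (rankOneProgram (.div (.ofNat (.const 1)) (.add (.ofNat (.const 1)) (.var 0)))) <|
  .seq (.setNat 8 (.add (.var 2) (.const 1))) <|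
  .seq findSmallLeverage <|
  .seq (.setNat 5 (.get 0 (.var 9))) <|
  .seq (rankOneProgram (.div (.ofNat (.const 1)) (.sub (.var 0) (.ofNat (.const 1))))) <|
  .putNat 0 (.var 9) (.get 0 (.var 2))

theorem exchangeProgram_ends {d k p : ℕ} {s : State} {M : ℕ → ℕ → ℝ} (hd : s.natVar 0 = d)
    (hk : s.natVar 1 = k) (hn : s.natVar 2 = 4 * k) (hp : s.natVar 7 = p + 1)
    (hM : s.realArr 0 = M) (hpd : p < d)
    (hg : 1 / 2 < arrayRow k M p ⬝ᵥ arrayRow k (s.realArr 2) p)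
    (h : IsDualArray d k M (s.realArr 2) (s.natArr 0) (4 * k))
    (hdet : 0 < (momentMatrix (arrayRow k M) (s.natArr 0) (4 * k)).det) :
    Ends exchangeProgram s
      (2 * (d * (38 * k + 28) + 32 * k) + (4 * k + 1) * (18 * k + 36) + 94) fun s' =>
      IsDualArray d k M (s'.realArr 2) (s'.natArr 0) (4 * k) ∧
      9 / 8 * (momentMatrix (arrayRow k M) (s.natArr 0) (4 * k)).det ≤
        (momentMatrix (arrayRow k M) (s'.natArr 0) (4 * k)).det := by
  set Y := s.realArr 2 with hY
  set S := s.natArr 0 with hS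
  refine (Ends.seq (T' := 2 * (d * (38 * k + 28) + 32 * k) + (4 * k + 1) * (18 * k + 36) + 90)
    (Ends.setNat ?_)).le ?_
  swap
  · simp only [NatExpr.cost]
    omega
  refine (Ends.seq (T' := 2 * (d * (38 * k + 28) + 32 * k) + (4 * k + 1) * (18 * k + 36) + 87)
    (Ends.putNat ?_)).le ?_
  swap
  · simp only [NatExpr.cost]
    omega
  set s₁ := (s.setNat 5 ((NatExpr.var 7).sub (.const 1) |>.eval s)).putNat 0
    ((NatExpr.var 2).eval (s.setNat 5 ((NatExpr.var 7).sub (.const 1) |>.eval s)))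
    ((NatExpr.var 5).eval (s.setNat 5 ((NatExpr.var 7).sub (.const 1) |>.eval s))) with hs₁
  have hp₁ : s₁.natVar 5 = p := by simp [hs₁, State.putNat, State.setNat, NatExpr.eval, hp]
  have hS₁ : s₁.natArr 0 = fun x => if x = 4 * k then p else S x := by
    ext x
    simp [hs₁, State.putNat, State.setNat, NatExpr.eval, hp, hn, hS]
  have hd₁ : s₁.natVar 0 = d := hd
  have hk₁ : s₁.natVar 1 = k := hk
  have hn₁ : s₁.natVar 2 = 4 * k := hn
  have hM₁ : s₁.realArr 0 = M := hM
  have hY₁ : s₁.realArr 2 = Y := rfl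
  clear_value s₁
  refine (Ends.bind (T' := d * (38 * k + 28) + 32 * k + (4 * k + 1) * (18 * k + 36) + 52)
    (rankOneProgram_ends hd₁ hk₁ hp₁ hM₁ hY₁
    (c := 1 / (1 + arrayRow k M p ⬝ᵥ arrayRow k Y p)) ?_) fun s₂ hF₂ h₂ => ?_).le ?_
  · intro s' hs'
    simp [RealExpr.eval, NatExpr.eval, hs']
  swap
  · simp only [RealExpr.cost, NatExpr.cost]
    omega
  obtain ⟨hdual₂, hdet₂⟩ := h.insert (Y' := s₂.realArr 2) (S' := s₂.natArr 0) hdet.ne' hpd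
    (fun x hx => by rw [hF₂.natArr 0 rfl, hS₁]; exact if_neg hx.ne)
    (by rw [hF₂.natArr 0 rfl, hS₁]; exact if_pos rfl) h₂
  have hd₂ : s₂.natVar 0 = d := (hF₂.natVar 0 rfl).trans hd₁
  have hk₂ : s₂.natVar 1 = k := (hF₂.natVar 1 rfl).trans hk₁
  have hn₂ : s₂.natVar 2 = 4 * k := (hF₂.natVar 2 rfl).trans hn₁
  have hM₂ : s₂.realArr 0 = M := (hF₂.realArr 0 rfl).trans hM₁
  have hpos₂ : 3 / 2 * (momentMatrix (arrayRow k M) S (4 * k)).det ≤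
      (momentMatrix (arrayRow k M) (s₂.natArr 0) (4 * k + 1)).det := by
    rw [hdet₂]
    nlinarith
  have hne₂ : 0 < (momentMatrix (arrayRow k M) (s₂.natArr 0) (4 * k + 1)).det := by linarith
  set S₂ := s₂.natArr 0 with hS₂
  set Y₂ := s₂.realArr 2 with hY₂
  refine (Ends.seq (T' := d * (38 * k + 28) + 32 * k + (4 * k + 1) * (18 * k + 36) + 48)
    (Ends.setNat ?_)).le ?_
  swap
  · simp only [NatExpr.cost]
    omega
  simp only [NatExpr.eval, hn₂]
  refine (Ends.bind (T' := d * (38 * k + 28) + 32 * k + 42) (findSmallLeverage_ends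
    (s := s₂.setNat 8 (4 * k + 1)) (n := 4 * k + 1) (M := M) (Y := Y₂) (S := S₂) hk₂
    (by simp [State.setNat]) hM₂ rfl rfl (hdual₂.exists_leverage_le hne₂.ne'))
    fun s₃ hF₃ h₃ => ?_).le (by omega)
  obtain ⟨q, hq₃⟩ : ∃ q, s₃.natVar 9 = q := ⟨_, rfl⟩
  rw [hq₃] at h₃
  obtain ⟨hq, hgq⟩ := h₃
  have hS₃ : s₃.natArr 0 = S₂ := hF₃.natArr 0 rfl
  refine (Ends.seq (T' := d * (38 * k + 28) + 32 * k + 39) (Ends.setNat ?_)).le ?_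
  swap
  · simp only [NatExpr.cost]
    omega
  simp only [NatExpr.eval, hq₃, hS₃]
  refine (Ends.bind (rankOneProgram_ends (M := M) (Y := Y₂)
    (s := s₃.setNat 5 (S₂ q)) (p := S₂ q)
    (c := 1 / (arrayRow k M (S₂ q) ⬝ᵥ arrayRow k Y₂ (S₂ q) - 1))
    ((hF₃.natVar 0 rfl).trans hd₂) ((hF₃.natVar 1 rfl).trans hk₂) (by simp [State.setNat])
    ((hF₃.realArr 0 rfl).trans hM₂) (hF₃.realArr 2 rfl) ?_)
    (T' := 4) fun s₄ hF₄ h₄ => Ends.putNat ?_).le ?_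
  · intro s' hs'
    simp [RealExpr.eval, NatExpr.eval, hs']
  swap
  · simp only [RealExpr.cost, NatExpr.cost]
    omega
  have hn₄ : s₄.natVar 2 = 4 * k := (hF₄.natVar 2 rfl).trans ((hF₃.natVar 2 rfl).trans hn₂)
  have hq₄ : s₄.natVar 9 = q := (hF₄.natVar 9 rfl).trans hq₃
  have hS₄ : s₄.natArr 0 = S₂ := (hF₄.natArr 0 rfl).trans hS₃
  -- The cell at position 4k is not erased; the list is only read below 4k from here on. If q = 4k
  -- the final write changes nothing.
  obtain ⟨hdual₅, hdet₅⟩ := hdual₂.remove (Y' := s₄.realArr 2)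
    (S' := fun x => if x = q then S₂ (4 * k) else S₂ x) hne₂.ne' (Nat.le_of_lt_succ hq)
    (by linarith) (fun _ _ => rfl) h₄
  simp only [State.putNat, NatExpr.eval, hn₄, hq₄, hS₄, true_and]
  refine ⟨hdual₅, ?_⟩
  rw [hdet₅]
  -- Insertion gained a factor 3/2 and removal keeps at least 3/4 of it: 3/2 · 3/4 = 9/8.
  nlinarith

/-- Exchanges rows until all leverages are at most `1 / 2`. -/
def improveProgram : Program :=
  .seq (.setNat 7 (.const 1)) <|
  .loop (.natLt (.const 0) (.var 7)) <|
    .seq findLargeLeverage <|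
    .cond (.natLt (.const 0) (.var 7)) exchangeProgram .skip

theorem improveProgram_ends {d k N : ℕ} {s : State} {M : ℕ → ℕ → ℝ} (hd : s.natVar 0 = d)
    (hk : s.natVar 1 = k) (hn : s.natVar 2 = 4 * k) (hM : s.realArr 0 = M)
    (h : IsDualArray d k M (s.realArr 2) (s.natArr 0) (4 * k))
    (hdet : 1 ≤ (momentMatrix (arrayRow k M) (s.natArr 0) (4 * k)).det)
    (hN : ∀ (m : ℕ) (T : ℕ → ℕ), (∀ x < 4 * k, T x < d) →
      (9 / 8 : ℝ) ^ m ≤ (momentMatrix (arrayRow k M) T (4 * k)).det → m ≤ N) :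
    Ends improveProgram s ((N + 1) * (2 * (d * (38 * k + 28) + 32 * k) +
      (4 * k + 1) * (18 * k + 36) + d * (18 * k + 36) + 111) + 6) fun s' =>
      IsDualArray d k M (s'.realArr 2) (s'.natArr 0) (4 * k) ∧
      0 < (momentMatrix (arrayRow k M) (s'.natArr 0) (4 * k)).det ∧
      ∀ i < d, arrayRow k M i ⬝ᵥ arrayRow k (s'.realArr 2) i ≤ 1 / 2 := by
  -- The last pass makes no exchange, so the growth (9/8)^m is claimed only while the flag in
  -- variable 7 is nonzero; a zero flag certifies small leverages instead. Together with `hN` the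
  -- growth bounds the number of passes.
  refine (Ends.seq (Ends.setNat (Ends.mono (Ends.loop (N := N)
    (T := 2 * (d * (38 * k + 28) + 32 * k) +
      (4 * k + 1) * (18 * k + 36) + d * (18 * k + 36) + 107) (fun m s' =>
      IsDualArray d k M (s'.realArr 2) (s'.natArr 0) (4 * k) ∧
      0 < (momentMatrix (arrayRow k M) (s'.natArr 0) (4 * k)).det ∧
      (s'.natVar 7 ≠ 0 →
        (9 / 8 : ℝ) ^ m ≤ (momentMatrix (arrayRow k M) (s'.natArr 0) (4 * k)).det) ∧
      (s'.natVar 7 = 0 → ∀ i < d, arrayRow k M i ⬝ᵥ arrayRow k (s'.realArr 2) i ≤ 1 / 2))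
      ?_ ?_ ?_) ?_))).le ?_
  · refine ⟨h, by positivity, fun _ => by simpa [State.setNat] using hdet, fun h0 => ?_⟩
    simp [State.setNat, NatExpr.eval] at h0
  · rintro m s' ⟨hI, _, hI', _⟩ hb
    simp only [Test.Holds, NatExpr.eval] at hb
    exact hN m _ hI.lt (hI' hb.ne')
  · rintro m s₁ hF₁ ⟨hI, hpos, hI', _⟩ hb
    simp only [Test.Holds, NatExpr.eval] at hb
    have hd₁ : s₁.natVar 0 = d := (hF₁.natVar 0 rfl).trans hd
    have hk₁ : s₁.natVar 1 = k := (hF₁.natVar 1 rfl).trans hk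
    have hn₁ : s₁.natVar 2 = 4 * k := (hF₁.natVar 2 rfl).trans hn
    have hM₁ : s₁.realArr 0 = M := (hF₁.realArr 0 rfl).trans hM
    refine (Ends.bind (findLargeLeverage_ends hd₁ hk₁ hM₁ rfl) fun s₂ hF₂ h₂ =>
      Ends.cond (T := 2 * (d * (38 * k + 28) + 32 * k) + (4 * k + 1) * (18 * k + 36) + 94)
        (T' := 1) (fun hb₂ => ?_) fun hb₂ => Ends.skip ?_).le ?_
    · simp only [Test.Holds, NatExpr.eval] at hb₂
      obtain ⟨p, hp⟩ := Nat.exists_eq_succ_of_ne_zero hb₂.ne'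
      obtain ⟨hpd, hg⟩ := h₂.2 p hp
      have hY₂ : s₂.realArr 2 = s₁.realArr 2 := hF₂.realArr 2 rfl
      have hS₂ : s₂.natArr 0 = s₁.natArr 0 := hF₂.natArr 0 rfl
      rw [← hY₂] at hg hI
      rw [← hS₂] at hI hpos hI'
      refine (exchangeProgram_ends ((hF₂.natVar 0 rfl).trans hd₁) ((hF₂.natVar 1 rfl).trans hk₁)
        ((hF₂.natVar 2 rfl).trans hn₁) hp ((hF₂.realArr 0 rfl).trans hM₁) hpd hg hI hpos).mono ?_
      rintro s₃ hF₃ ⟨hdual, hle⟩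
      refine ⟨hdual, by linarith, fun _ => ?_, fun h0 => ?_⟩
      · rw [pow_succ]
        linarith [hI' hb.ne']
      · rw [hF₃.natVar 7 rfl] at h0
        omega
    · simp only [Test.Holds, NatExpr.eval, not_lt, Nat.le_zero] at hb₂
      rw [hF₂.natArr 0 rfl, hF₂.realArr 2 rfl]
      exact ⟨hI, hpos, fun h => absurd hb₂ h, fun _ => h₂.1 hb₂⟩
    · simp only [Test.cost, NatExpr.cost]
      omega
  · rintro s' _ ⟨hb, m, hI, hpos, _, hfin⟩
    simp only [Test.Holds, NatExpr.eval, not_lt, Nat.le_zero] at hb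
    exact ⟨hI, hpos, hfin hb⟩
  · simp only [Test.cost, NatExpr.cost]
    exact le_of_eq (by ring)

/-- Array `1` receives the inner products of the rows of array `2` with the listed rows of
array `0`. -/
def outputProgram : Program :=
  .forLt 4 0 <| .forLt 6 2 <|
    .seq (.setNat 5 (.get 0 (.var 6))) <|
    .seq (dotProgram 2 4 0 5) <|
    .putReal 1 (.var 4) (.var 6) (.var 0)

theorem outputProgram_ends {d k n : ℕ} {s : State} {M Y : ℕ → ℕ → ℝ} {S : ℕ → ℕ}
    (hd : s.natVar 0 = d) (hk : s.natVar 1 = k) (hn : s.natVar 2 = n) (hM : s.realArr 0 = M)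
    (hY : s.realArr 2 = Y) (hS : s.natArr 0 = S) :
    Ends outputProgram s (d * (n * (18 * k + 24) + 14) + 6) fun s' =>
      ∀ i < d, ∀ x < n, s'.realArr 1 i x = arrayRow k Y i ⬝ᵥ arrayRow k M (S x) := by
  refine (Ends.forLt (n := d) (T := n * (18 * k + 24) + 6) (fun y s' =>
    ∀ i < y, ∀ x < n, s'.realArr 1 i x = arrayRow k Y i ⬝ᵥ arrayRow k M (S x))
    hd (by decide) rfl rfl (by simp) ?_)
  intro i s₁ hi hF₁ hi₁ hI
  refine ((Ends.forLt (n := n) (T := 18 * k + 16) (fun y s' =>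
    (∀ i' < i, ∀ x < n, s'.realArr 1 i' x = arrayRow k Y i' ⬝ᵥ arrayRow k M (S x)) ∧
    ∀ x < y, s'.realArr 1 i x = arrayRow k Y i ⬝ᵥ arrayRow k M (S x))
    ((hF₁.natVar 2 rfl).trans hn) (by decide) rfl rfl ⟨hI, by simp⟩ ?_).mono
      fun s' _ h => ?_)
  · rintro x s₂ hx hF₂ hx₂ ⟨hJ, hJ'⟩
    have hi₂ : s₂.natVar 4 = i := (hF₂.natVar 4 rfl).trans hi₁
    have hk₂ : s₂.natVar 1 = k := (hF₂.natVar 1 rfl).trans ((hF₁.natVar 1 rfl).trans hk)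
    have hM₂ : s₂.realArr 0 = M := (hF₂.realArr 0 rfl).trans ((hF₁.realArr 0 rfl).trans hM)
    have hY₂ : s₂.realArr 2 = Y := (hF₂.realArr 2 rfl).trans ((hF₁.realArr 2 rfl).trans hY)
    have hS₂ : s₂.natArr 0 = S := (hF₂.natArr 0 rfl).trans ((hF₁.natArr 0 rfl).trans hS)
    refine (Ends.seq (T' := 18 * k + 13) (Ends.setNat ?_)).le ?_
    · simp only [NatExpr.eval, hS₂, hx₂]
      refine (Ends.bind (T' := 4) (dotProgram_ends (a := 2) (x := 4) (a' := 0) (x' := 5) (k := k)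
        (s := s₂.setNat 5 (S x))
        hk₂ (by decide) (by decide)) fun s₃ hF₃ h₃ => ?_).le ?_
      · refine Ends.putReal ?_
        simp only [State.setNat, if_true, Nat.reduceEqDiff, if_false] at h₃
        rw [hi₂, hM₂, hY₂] at h₃
        have h4 : s₃.natVar 4 = i := (hF₃.natVar 4 rfl).trans hi₂
        have h6 : s₃.natVar 6 = x := (hF₃.natVar 6 rfl).trans hx₂
        have h1 : s₃.realArr 1 = s₂.realArr 1 := hF₃.realArr 1 rfl
        simp only [State.putReal, State.setNat, NatExpr.eval, RealExpr.eval, h4, h6, h1, h₃,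
          true_and]
        refine ⟨fun i' hi' x' hx' => ?_, fun x' hx' => ?_⟩
        · rw [if_neg (by omega), hJ i' hi' x' hx']
        · rcases Nat.lt_succ_iff_lt_or_eq.mp hx' with hx' | rfl
          · rw [if_neg hx'.ne, hJ' x' hx']
          · rw [if_pos rfl]
      · omega
    · simp only [NatExpr.cost]
      omega
  · intro i' hi' x hx
    simp only [State.setNat]
    rcases Nat.lt_succ_iff_lt_or_eq.mp hi' with hi' | rfl
    · exact h.1 i' hi' x hx
    · exact h.2 x hx

end RealRAM

/-! ### Initial memory and numerical estimates -/

theorem Eliminated.zero {d k : ℕ} {U : Submodule ℝ (Fin d → ℝ)} (b : Module.Basis (Fin k) ℝ U)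
    (S : ℕ → ℕ) :
    Eliminated k U 0 ((RealRAM.inputState (basisMatrix b)).realArr 0) S := by
  have hM : ∀ (i : Fin d) (j : Fin k),
      (RealRAM.inputState (basisMatrix b)).realArr 0 i j = (b j : Fin d → ℝ) i := fun i j => by
    simp [RealRAM.inputState, basisMatrix]
  refine ⟨fun j hj => ?_, fun z hz j hj => ?_, by simp, by simp, ⟨fun _ _ => 0, by simp⟩⟩
  · have : (fun i : Fin d => (RealRAM.inputState (basisMatrix b)).realArr 0 i j) =
        (b ⟨j, hj⟩ : Fin d → ℝ) := funext fun i => hM i ⟨j, hj⟩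
    rw [this]
    exact (b ⟨j, hj⟩).2
  · refine Fintype.linearIndependent_iff.mp b.linearIndependent (fun j => z j) ?_ ⟨j, hj⟩
    ext i
    have := hz i i.2
    rw [← Fin.sum_univ_eq_sum_range
      fun c => (RealRAM.inputState (basisMatrix b)).realArr 0 i c * z c] at this
    simpa [hM, mul_comm] using this

/-- Take logarithms, with k! ≤ (4k)^k and log(9/8) ≥ 1 - 8/9 = 1/9; hence 18 = 2 · 9. -/
theorem le_of_pow_le_factorial_mul_pow {k m : ℕ} (hk : 1 ≤ k)
    (h : (9 / 8 : ℝ) ^ m ≤ k.factorial * ((4 * k : ℕ) : ℝ) ^ k) :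
    m ≤ ⌊18 * k * Real.log (4 * k)⌋₊ := by
  have hk' : (1 : ℝ) ≤ k := by exact_mod_cast hk
  have h₁ : (k.factorial : ℝ) ≤ (4 * k : ℝ) ^ k := by
    refine (show (k.factorial : ℝ) ≤ (k : ℝ) ^ k by exact_mod_cast k.factorial_le_pow).trans ?_
    exact pow_le_pow_left₀ (by positivity) (by linarith) k
  have h₂ : (9 / 8 : ℝ) ^ m ≤ (4 * k : ℝ) ^ (2 * k) := by
    refine h.trans ?_
    push_cast
    rw [two_mul, pow_add]
    exact mul_le_mul_of_nonneg_right h₁ (by positivity)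
  have h₃ := Real.log_le_log (by positivity) h₂
  rw [Real.log_pow, Real.log_pow] at h₃
  have h₄ := Real.one_sub_inv_le_log_of_pos (show (0 : ℝ) < 9 / 8 by norm_num)
  refine Nat.le_floor ?_
  have h₅ : (m : ℝ) * (1 / 9) ≤ m * Real.log (9 / 8) :=
    mul_le_mul_of_nonneg_left (by linarith) (Nat.cast_nonneg m)
  push_cast at h₃
  linarith

/-- The claim is k (1 - log log k) ≤ 4. For k = 1, `Real.log 0 = 0` makes the right side 16. For 2 ≤
k ≤ 8, log x ≥ 1 - 1/x at x = log k reduces it to k ≤ 4 log k. For 9 ≤ k ≤ 16, log log k ≥ 3/4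
suffices, and beyond that log log k ≥ 1. -/
theorem four_mul_le_log_log {k : ℕ} (hk : 1 ≤ k) :
    4 * (k : ℝ) ≤ 4 * (k : ℝ) * Real.log (Real.log k) + 16 := by
  have hexp := Real.exp_one_lt_d9.le
  have hpow : ∀ n : ℕ, Real.exp n ≤ 2.7182818286 ^ n := fun n => by
    rw [← Real.exp_one_pow]
    exact pow_le_pow_left₀ (Real.exp_pos 1).le hexp n
  have hk₀ : (0 : ℝ) < k := by exact_mod_cast hk
  rcases hk.eq_or_lt with rfl | hk₁
  · norm_num
  rcases le_or_gt k 8 with hk₈ | hk₈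
  · have h₁ : Real.exp k ≤ (k : ℝ) ^ 4 := by
      refine (hpow k).trans ?_
      interval_cases k <;> norm_num
    have h₂ : (k : ℝ) ≤ 4 * Real.log k := by
      have := (Real.le_log_iff_exp_le (by positivity)).mpr h₁
      rwa [Real.log_pow] at this
    have h₃ : 0 < Real.log k := by linarith
    have h₄ := Real.one_sub_inv_le_log_of_pos h₃
    have h₅ : (k : ℝ) * (Real.log k)⁻¹ ≤ 4 := by
      rw [← div_eq_mul_inv, div_le_iff₀ h₃]
      exact h₂
    nlinarith
  rcases le_or_gt k 16 with hk₁₆ | hk₁₆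
  · have h₁ : (17 / 8 : ℝ) ≤ Real.log k := by
      have h₂ : (17 : ℝ) ≤ Real.log (9 ^ 8) := by
        rw [Real.le_log_iff_exp_le (by positivity)]
        refine le_trans (by exact_mod_cast hpow 17) ?_
        norm_num
      rw [Real.log_pow] at h₂
      have h₃ : Real.log 9 ≤ Real.log k :=
        Real.log_le_log (by norm_num) (by exact_mod_cast hk₈)
      push_cast at h₂
      linarith
    have h₂ : (3 / 4 : ℝ) ≤ Real.log (Real.log k) := by
      have h₃ : (3 : ℝ) ≤ Real.log ((17 / 8) ^ 4) := by
        rw [Real.le_log_iff_exp_le (by positivity)]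
        refine le_trans (by exact_mod_cast hpow 3) ?_
        norm_num
      rw [Real.log_pow] at h₃
      have h₄ := Real.log_le_log (by norm_num) h₁
      push_cast at h₃
      linarith
    have h₃ : (k : ℝ) ≤ 16 := by exact_mod_cast hk₁₆
    nlinarith
  · have h₁ : Real.exp 1 ≤ Real.log k := by
      have h₂ : Real.log (2 ^ 4) ≤ Real.log k := by
        refine Real.log_le_log (by norm_num) ?_
        norm_num
        exact_mod_cast hk₁₆.le
      rw [Real.log_pow] at h₂
      have := Real.log_two_gt_d9
      push_cast at h₂
      linarith
    have h₂ : 1 ≤ Real.log (Real.log k) := by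
      have := Real.log_le_log (Real.exp_pos 1) h₁
      rwa [Real.log_exp] at this
    nlinarith

/-! ### The whole program and the theorem -/

namespace RealRAM

/-- Computes a core set of rows and the reconstruction matrix. -/
def coreProgram : Program :=
  .seq eliminateColumns <| .seq startProgram <| .seq improveProgram outputProgram

theorem coreProgram_ends {d k : ℕ} (hk : 1 ≤ k) (hkd : k ≤ d) {U : Submodule ℝ (Fin d → ℝ)}
    (b : Module.Basis (Fin k) ℝ U) :
    Ends coreProgram (inputState (basisMatrix b))
      (420 * (d * k * k) + 631 * (d * k) * (⌊18 * k * Real.log (4 * k)⌋₊ + 1)) fun s =>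
      ∃ (M Y : ℕ → ℕ → ℝ) (S₀ S : ℕ → ℕ), Eliminated k U k M S₀ ∧
        IsDualArray d k M Y S (4 * k) ∧
        (momentMatrix (arrayRow k M) S (4 * k)).det ≠ 0 ∧
        (∀ i < d, arrayRow k M i ⬝ᵥ arrayRow k Y i ≤ 1 / 2) ∧
        s.natVar 2 = 4 * k ∧ s.natArr 0 = S ∧
        ∀ i < d, ∀ x < 4 * k, s.realArr 1 i x = arrayRow k Y i ⬝ᵥ arrayRow k M (S x) := by
  set N := ⌊18 * k * Real.log (4 * k)⌋₊
  refine (Ends.bind (eliminateColumns_ends (d := d) (k := k) (U := U)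
    (by simp [inputState]) (by simp [inputState]) (by omega) (Eliminated.zero b _))
    (T' := (d * (17 * k + 14) + 32 * k + 20) + (((N + 1) * (2 * (d * (38 * k + 28) + 32 * k) +
      (4 * k + 1) * (18 * k + 36) + d * (18 * k + 36) + 111) + 6) +
      (d * (4 * k * (18 * k + 24) + 14) + 6)))
    fun s₁ hF₁ h₁ => ?_).le ?_
  · have hd₁ : s₁.natVar 0 = d := by
      rw [hF₁.natVar 0 rfl]
      simp [inputState]
    have hk₁ : s₁.natVar 1 = k := by
      rw [hF₁.natVar 1 rfl]
      simp [inputState]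
    refine Ends.bind (startProgram_ends hd₁ hk₁ rfl rfl) fun s₂ hF₂ h₂ => ?_
    obtain ⟨hn₂, hS₂, hY₂⟩ := h₂
    have hd₂ : s₂.natVar 0 = d := (hF₂.natVar 0 rfl).trans hd₁
    have hk₂ : s₂.natVar 1 = k := (hF₂.natVar 1 rfl).trans hk₁
    have hM₂ : s₂.realArr 0 = s₁.realArr 0 := hF₂.realArr 0 rfl
    obtain ⟨hdual, hdet⟩ := h₁.isDualArray hS₂ hY₂
    refine Ends.bind (improveProgram_ends hd₂ hk₂ hn₂ hM₂ hdual hdet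
      fun m T hT hm => le_of_pow_le_factorial_mul_pow hk
        (hm.trans (h₁.det_momentMatrix_le T (4 * k) hT))) fun s₃ hF₃ h₃ => ?_
    obtain ⟨hdual₃, hdet₃, hle₃⟩ := h₃
    have hn₃ : s₃.natVar 2 = 4 * k := (hF₃.natVar 2 rfl).trans hn₂
    refine (outputProgram_ends ((hF₃.natVar 0 rfl).trans hd₂) ((hF₃.natVar 1 rfl).trans hk₂)
      hn₃ ((hF₃.realArr 0 rfl).trans hM₂) rfl rfl).mono fun s₄ hF₄ h₄ => ?_
    exact ⟨_, _, _, _, h₁, hdual₃, hdet₃.ne', hle₃, (hF₄.natVar 2 rfl).trans hn₃,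
      hF₄.natArr 0 rfl, h₄⟩
  -- All lower-order terms are absorbed into dk or dk²; the k² from scanning the list needs k ≤ d.
  · have hd : 1 ≤ d := hk.trans hkd
    have e₁ : 1 ≤ d * k := Nat.mul_pos hd hk
    have e₂ : d ≤ d * k := Nat.le_mul_of_pos_right d hk
    have e₃ : k ≤ d * k := Nat.le_mul_of_pos_left k hd
    have e₄ : k * k ≤ d * k := Nat.mul_le_mul_right k hkd
    have e₅ : d * k ≤ d * k * k := Nat.le_mul_of_pos_right _ hk
    have f₁ : k * (20 * (d * k) + 51 * d + 14 * k + 35) + 6 ≤ 126 * (d * k * k) := by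
      have : k * (20 * (d * k) + 51 * d + 14 * k + 35) ≤ k * (120 * (d * k)) :=
        Nat.mul_le_mul_left k (by linarith)
      linarith
    have f₂ : d * (17 * k + 14) + 32 * k + 20 ≤ 83 * (d * k * k) := by linarith
    have f₃ : 2 * (d * (38 * k + 28) + 32 * k) + (4 * k + 1) * (18 * k + 36) +
        d * (18 * k + 36) + 111 ≤ 631 * (d * k) := by linarith
    have f₄ : d * (4 * k * (18 * k + 24) + 14) + 6 ≤ 188 * (d * k * k) := by linarith
    have f₅ := Nat.mul_le_mul_left (N + 1) f₃
    linarith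

end RealRAM

/-- One fixed program serves all `d`, `k` and `U`; the subspace is given to it by an arbitrary basis.
The norm on `Fin d → ℝ` is the maximum norm. -/
theorem lemma1 :
    ∃ (P : RealRAM.Program) (C : ℝ) (c : ℕ),
      ∀ (d k : ℕ) (_ : 1 ≤ k) (U : Submodule ℝ (Fin d → ℝ)) (b : Module.Basis (Fin k) ℝ U),
        ∃ (s : RealRAM.State) (t : ℕ),
          RealRAM.Runs P (RealRAM.inputState (basisMatrix b)) s t ∧
          (t : ℝ) ≤ C * ((d : ℝ) * (k : ℝ) ^ 2) * (1 + Real.log ((d : ℝ) * (k : ℝ) ^ 2)) ^ c ∧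
          ∃ (n : ℕ) (core : Fin n → Fin d) (L : Matrix (Fin d) (Fin n) ℝ),
            s.Outputs core L ∧
            (n : ℝ) ≤ 4 * (k : ℝ) * Real.log (Real.log (k : ℝ)) + 16 ∧
            (∀ u ∈ U, ∀ v ∈ U,
              ‖u - v‖ ≤ Real.sqrt (2 * (k : ℝ)) * ⨆ j : Fin n, |u (core j) - v (core j)|) ∧
            (∀ w : Fin n → ℝ, L.mulVec w ∈ U) ∧
            ∀ v ∈ U, L.mulVec (fun j => v (core j)) = v := by
  -- At most 37k(1 + ℓ) passes are budgeted, where ℓ = log(dk²), and 420 + 631 · 37 = 23767.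
  refine ⟨RealRAM.coreProgram, 24000, 1, fun d k hk U b => ?_⟩
  have hrank : Module.finrank ℝ U = k := by simp [Module.finrank_eq_card_basis b]
  have hkd : k ≤ d := by
    have := Submodule.finrank_le U
    rwa [hrank, Module.finrank_fin_fun] at this
  obtain ⟨s, t, hrun, ht, M, Y, S₀, S, helim, hdual, hdet, hle, hn, hS, hL⟩ :=
    RealRAM.coreProgram_ends hk hkd b
  refine ⟨s, t, hrun, ?_, 4 * k, fun x => ⟨S x, hdual.lt x x.2⟩,
    Matrix.of fun i x => s.realArr 1 i x, ⟨hn, fun x => by rw [hS], fun _ _ => rfl⟩, ?_, ?_, ?_, ?_⟩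
  · have hk' : (1 : ℝ) ≤ k := by exact_mod_cast hk
    have hd' : (1 : ℝ) ≤ d := by exact_mod_cast hk.trans hkd
    have hlog : Real.log k ≤ Real.log ((d : ℝ) * (k : ℝ) ^ 2) :=
      Real.log_le_log (by linarith) (by nlinarith [mul_le_mul hd' hk' zero_le_one (by linarith)])
    have hlog₀ : 0 ≤ Real.log k := Real.log_nonneg hk'
    have hlog4 : Real.log 4 ≤ 2 := by
      rw [show (4 : ℝ) = 2 ^ 2 by norm_num, Real.log_pow]
      have := Real.log_two_lt_d9
      push_cast
      linarith
    have hfloor := Nat.floor_le (show 0 ≤ 18 * k * Real.log (4 * k) from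
      mul_nonneg (by positivity) (Real.log_nonneg (by linarith)))
    have ht' : (t : ℝ) ≤ 420 * (d * k * k) +
        631 * (d * k) * (⌊18 * k * Real.log (4 * k)⌋₊ + 1) := by exact_mod_cast ht
    rw [Real.log_mul (by norm_num) (by positivity)] at hfloor ht'
    set ℓ := Real.log ((d : ℝ) * (k : ℝ) ^ 2)
    have h₁ : 18 * (k : ℝ) * (Real.log 4 + Real.log k) ≤ 18 * k * (2 + ℓ) :=
      mul_le_mul_of_nonneg_left (by linarith) (by positivity)
    have h₂ : (⌊18 * (k : ℝ) * (Real.log 4 + Real.log k)⌋₊ : ℝ) + 1 ≤ 37 * k * (1 + ℓ) := by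
      nlinarith
    have h₃ : 631 * ((d : ℝ) * k) * (⌊18 * (k : ℝ) * (Real.log 4 + Real.log k)⌋₊ + 1) ≤
        631 * (d * k) * (37 * k * (1 + ℓ)) := mul_le_mul_of_nonneg_left h₂ (by positivity)
    have h₄ : 0 ≤ (d : ℝ) * k * k * ℓ := mul_nonneg (by positivity) (by linarith)
    have h₅ : 0 ≤ (d : ℝ) * k * k := by positivity
    rw [pow_one]
    linarith
  · push_cast
    exact four_mul_le_log_log hk
  · intro u hu v hv
    obtain ⟨z, hz⟩ := helim.exists_eq_dotProduct hrank (U.sub_mem hu hv)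
    set m := ⨆ j : Fin (4 * k), |u ⟨S j, hdual.lt j j.2⟩ - v ⟨S j, hdual.lt j j.2⟩|
    have hm₀ : 0 ≤ m := Real.iSup_nonneg fun _ => abs_nonneg _
    have hm : ∀ x ∈ Finset.range (4 * k), (arrayRow k M (S x) ⬝ᵥ z) ^ 2 ≤ m ^ 2 := by
      intro x hx
      have hx' := Finset.mem_range.mp hx
      rw [← hz ⟨S x, hdual.lt x hx'⟩, sq_le_sq, abs_of_nonneg hm₀]
      exact le_ciSup (f := fun j : Fin (4 * k) =>
        |u ⟨S j, hdual.lt j j.2⟩ - v ⟨S j, hdual.lt j j.2⟩|) (Set.finite_range _).bddAbove ⟨x, hx'⟩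
    rw [pi_norm_le_iff_of_nonneg (by positivity)]
    intro i
    rw [Real.norm_eq_abs]
    refine abs_le_of_sq_le_sq ?_ (by positivity)
    rw [hz i, mul_pow, Real.sq_sqrt (by positivity)]
    have h₁ := sq_dotProduct_le_of_vecMul_momentMatrix (hdual.vecMul i i.2) z
    have h₂ := Finset.sum_le_card_nsmul _ _ _ hm
    rw [Finset.card_range, nsmul_eq_mul] at h₂
    -- Leverage at most 1/2 times 4k summands at most m² gives 2k m².
    have h₃ := mul_le_mul (hle i i.2) h₂ (Finset.sum_nonneg fun _ _ => sq_nonneg _) (by norm_num)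
    push_cast at h₃
    linarith
  · intro w
    set V := momentMatrix (arrayRow k M) S (4 * k)
    -- Since Y = M V⁻¹, the vector L w is M applied to a vector of ℝ^k, hence lies in the column
    -- span.
    have : (Matrix.of fun (i : Fin d) (x : Fin (4 * k)) => s.realArr 1 i x) *ᵥ w =
        fun i : Fin d => arrayRow k M i ⬝ᵥ
          (V⁻¹ *ᵥ ∑ x : Fin (4 * k), w x • arrayRow k M (S x)) := by
      ext i
      have hy : arrayRow k Y i = arrayRow k M i ᵥ* V⁻¹ := by
        rw [← hdual.vecMul i i.2, vecMul_vecMul,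
          mul_nonsing_inv _ (isUnit_iff_ne_zero.mpr hdet), vecMul_one]
      rw [dotProduct_mulVec, ← hy, dotProduct_sum]
      change ∑ x : Fin (4 * k), s.realArr 1 i x * w x = _
      refine Finset.sum_congr rfl fun x _ => ?_
      rw [dotProduct_smul, smul_eq_mul, hL i i.2 x x.2, mul_comm]
    rw [this]
    exact helim.mem_of_dotProduct _
  · intro v hv
    obtain ⟨z, hz⟩ := helim.exists_eq_dotProduct hrank hv
    ext i
    -- Replacing m_i by y_i V and expanding V over the list turns m_i · z into row i of L applied to
    -- the sampled values.
    rw [hz i, ← hdual.vecMul i i.2, vecMul_momentMatrix_dotProduct, ← Fin.sum_univ_eq_sum_range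
      fun x => (arrayRow k Y i ⬝ᵥ arrayRow k M (S x)) * (arrayRow k M (S x) ⬝ᵥ z)]
    change ∑ x : Fin (4 * k), s.realArr 1 i x * v ⟨S x, hdual.lt x x.2⟩ = _
    refine Finset.sum_congr rfl fun x _ => ?_
    rw [hL i i.2 x x.2, hz]
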